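/- Let $d\ge 1$ be an integer and $\alpha\ge 0$ a real number. For $K\subset\mathbb R^d$ and $\delta>0$ write $K_\delta=K+B(0,\delta)$, and let $|\cdot|$ denote Lebesgue measure. Let $\mathcal K_d(\alpha)$ be the class of compact sets $K\subset\mathbb R^d$ of Hausdorff dimension $\dim K=\alpha$ for which $K_\delta$ is a $\delta$-discrete $\alpha$-set in the sense of Katz and Tao, uniformly in $\delta$: there is a constant $C(K)$ such that $$|K_\delta\cap B(x,r)|\le C(K)\,(r/\delta)^\alpha\,\delta^d\qquad\text{for all } 0<\delta\le 1,\ x\in\mathbb R^d,\ r\ge\delta.$$ Put $D(K)=\{(k_1,k_2)\in K\times K: |k_2-k_1|=1\}\subset\mathbb R^{2d}$ and $g_d(\alpha)=\sup\{\dim D(K): K\in\mathcal K_d(\alpha)\}$, where $\dim$ is Hausdorff dimension. Let $\dim_M$ denote upper Minkowski dimension, $\dim_M A=\limsup_{\delta\to0+}\bigl(n-\log|A_\delta|/\log\delta\bigr)$ for $A\subset\mathbb R^n$ (with $\dim_M\emptyset=-\infty$). Then: 1. If $(d+1)/2\le\alpha\le d$, then $g_d(\alpha)=2\alpha-1$;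 moreover $\dim_M D(K)\le 2\alpha-1$ for every $K\in\mathcal K_d(\alpha)$. 2. If $\alpha\le(d+1)/2$, then $g_d(\alpha)\le\alpha+(d-1)/2$; moreover $\dim_M D(K)\le\alpha+(d-1)/2$ for every $K\in\mathcal K_d(\alpha)$. -/

import Mathlib

open scoped ENNReal Topology

noncomputable section

namespace UnitDistance

/-- The set `D(K)` of ordered pairs of points of `K` at distance one. The ambient space `ℝ^d × ℝ^d`
carries the max of the two Euclidean distances, which is bi-Lipschitz equivalent to the Euclidean
distance of `ℝ^(2d)`, so Hausdorff and Minkowski dimensions are the usual ones. -/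
def unitPairs {d : ℕ} (K : Set (EuclideanSpace ℝ (Fin d))) :
    Set (EuclideanSpace ℝ (Fin d) × EuclideanSpace ℝ (Fin d)) :=
  {p | p.1 ∈ K ∧ p.2 ∈ K ∧ ‖p.2 - p.1‖ = 1}

/-- The `δ`-neighbourhoods `K_δ = K + B(0, δ)` are `δ`-discrete `α`-sets in the sense of Katz and
Tao, with one constant for all scales: `|K_δ ∩ B(x, r)| ≤ C (r / δ)^α δ^d` for all `x` and `r ≥ δ`.
(For bounded `K` and `α ≥ 0` the scales `δ > 1` would add nothing.) -/
def IsDiscreteAlphaSet {d : ℕ} (α : ℝ) (K : Set (EuclideanSpace ℝ (Fin d))) : Prop :=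
  ∃ C : ℝ, ∀ δ : ℝ, 0 < δ → δ ≤ 1 → ∀ (x : EuclideanSpace ℝ (Fin d)) (r : ℝ), δ ≤ r →
    MeasureTheory.volume (Metric.thickening δ K ∩ Metric.ball x r) ≤
      ENNReal.ofReal (C * (r / δ) ^ α * δ ^ d)

/-- The compact sets of Hausdorff dimension `α` satisfying the regularity condition. -/
structure IsRegularSet {d : ℕ} (α : ℝ) (K : Set (EuclideanSpace ℝ (Fin d))) : Prop where
  isCompact : IsCompact K
  dimH_eq : dimH K = ENNReal.ofReal α
  isDiscreteAlphaSet : IsDiscreteAlphaSet α K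

/-- `g_d(α)`: the supremum of the Hausdorff dimension of `D(K)` over all regular compact sets
`K ⊆ ℝ^d` of dimension `α`. -/
def g (d : ℕ) (α : ℝ) : ℝ≥0∞ :=
  sSup {s | ∃ K : Set (EuclideanSpace ℝ (Fin d)), IsRegularSet α K ∧ s = dimH (unitPairs K)}

/-- The upper Minkowski dimension `limsup_{δ → 0+} (n - log |A_δ| / log δ)` of a subset `A` of an
`n`-dimensional space, where `A_δ` is the open `δ`-neighbourhood of `A`. The empty set has
dimension `-∞`, as `ENNReal.log 0 = ⊥`. -/
def upperMinkowskiDim {E : Type*} [NormedAddCommGroup E] [NormedSpace ℝ E]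
    [MeasureTheory.MeasureSpace E] (A : Set E) : EReal :=
  Filter.limsup (fun δ : ℝ => ((Module.finrank ℝ E : ℝ) : EReal) -
    ENNReal.log (MeasureTheory.volume (Metric.thickening δ A)) / (Real.log δ : EReal)) (𝓝[>] 0)

end UnitDistance

end

/-! Upper bounds. Write `μ` for Lebesgue measure on `K_δ`. The `δ`-neighbourhood of `D(K)` lies in
the set of pairs in `K_δ × K_δ` whose distance is within `2δ` of `1`. Up to a factor `δ^(-d)`, its
measure is therefore at most the integral of the Gaussian `exp (-|w|²/δ²)` against the convolution
of the law of `x - y` under `μ × μ` with Lebesgue measure `a` on an annulus of half-width `3δ`. On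
the Fourier side the integrand is a Gaussian times `|μ̂|² â`, and `|â(ξ)| ≲ δ min(1,
|ξ|^(-(d-1)/2))` by Bessel decay (`exists_norm_charFun_annulus_le_rpow`). Each dyadic range `|ξ| ~
2^j ≲ 1/δ` is dominated by a Gaussian, and so by the energy `2^(jd) ∬ exp (-4^j |x-y|²) dμ dμ ≲
2^(jd) (2^(-j)/δ)^α δ^d δ^(d-α)`. The sum is `δ^(1+2(d-α)) ∑ 2^(j((d+1)/2-α))`. Its low frequencies
give exponent `2α - 1`, its high frequencies `α + (d-1)/2`, and the larger one wins
(`exists_volume_thickening_unitPairs_le`). Volume bounds of this kind control both the Minkowski and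
the Hausdorff dimension. Lower bound. Take `K = [0,2] × T^(d-1)`, with `T` a short Cantor set (or
interval) of dimension `(α-1)/(d-1)` when `d > 1`. The first coordinate of the second point can be
solved for from the remaining coordinates, so `D(K)` projects by a Lipschitz map onto a set
containing `[0,1] × T^(d-1) × T^(d-1)`, of dimension `2α - 1` (`pi_subset_pairCoords_image`,
`le_g`). -/

noncomputable section

namespace UnitDistance

open MeasureTheory

/-! ### Bessel-type integrals and their decay. -/

/-- The integral `∫_0^π exp (i s cos θ) g θ dθ`. -/
def waveIntegral (g : ℝ → ℂ) (s : ℝ) : ℂ :=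
  ∫ θ in (0 : ℝ)..Real.pi, Complex.exp (Complex.I * (s * Real.cos θ : ℝ)) * g θ

theorem hasDerivAt_waveIntegral {g : ℝ → ℂ} (hg : Continuous g) (s : ℝ) :
    HasDerivAt (waveIntegral g)
      (waveIntegral (fun θ => Complex.I * Real.cos θ * g θ) s) s := by
  unfold waveIntegral
  refine (intervalIntegral.hasDerivAt_integral_of_dominated_loc_of_deriv_le
    (bound := fun θ => ‖g θ‖) (s := Set.univ) Filter.univ_mem
    (F := fun s θ => Complex.exp (Complex.I * (s * Real.cos θ : ℝ)) * g θ)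
    (F' := fun s θ => Complex.exp (Complex.I * (s * Real.cos θ : ℝ)) *
      (Complex.I * Real.cos θ * g θ)) ?_ ?_ ?_ ?_ ?_ ?_).2
  · exact Filter.Eventually.of_forall fun x => (by fun_prop : Continuous _).aestronglyMeasurable
  · exact (by fun_prop : Continuous _).intervalIntegrable _ _
  · exact (by fun_prop : Continuous _).aestronglyMeasurable
  · refine Filter.Eventually.of_forall fun θ _ x _ => ?_
    rw [norm_mul, norm_mul, norm_mul, Complex.norm_exp_I_mul_ofReal, Complex.norm_I, one_mul,
      one_mul, Complex.norm_real]
    exact mul_le_of_le_one_left (norm_nonneg _) (Real.abs_cos_le_one θ)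
  · exact (by fun_prop : Continuous _).intervalIntegrable _ _
  · refine Filter.Eventually.of_forall fun θ _ x _ => ?_
    have h1 : HasDerivAt (fun x : ℝ => Complex.I * ((x * Real.cos θ : ℝ) : ℂ))
        (Complex.I * ((1 * Real.cos θ : ℝ) : ℂ)) x :=
      (((hasDerivAt_id x).mul_const (Real.cos θ)).ofReal_comp).const_mul Complex.I
    convert! (h1.cexp).mul_const (g θ) using 1
    push_cast; ring

/-- The integral `∫_0^π exp (i s cos θ) sin θ ^ k dθ`, which is a constant multiple of
`J_{k/2}(s) / s^{k/2}` for the Bessel function `J_{k/2}`. -/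
def besselIntegral (k : ℕ) : ℝ → ℂ := waveIntegral fun θ => (Real.sin θ : ℂ) ^ k

/-- The derivative of `besselIntegral k`. -/
def besselIntegralDeriv (k : ℕ) : ℝ → ℂ :=
  waveIntegral fun θ => Complex.I * Real.cos θ * (Real.sin θ : ℂ) ^ k

theorem hasDerivAt_besselIntegral (k : ℕ) (s : ℝ) :
    HasDerivAt (besselIntegral k) (besselIntegralDeriv k s) s :=
  hasDerivAt_waveIntegral (by fun_prop) s

theorem hasDerivAt_besselIntegralDeriv (k : ℕ) (s : ℝ) :
    HasDerivAt (besselIntegralDeriv k) (besselIntegral (k + 2) s - besselIntegral k s) s := by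
  convert! hasDerivAt_waveIntegral
    (g := fun θ => Complex.I * Real.cos θ * (Real.sin θ : ℂ) ^ k) (by fun_prop) s using 1
  unfold besselIntegral waveIntegral
  rw [← intervalIntegral.integral_sub]
  · refine intervalIntegral.integral_congr fun θ _ => ?_
    have h : (Real.sin θ : ℂ) ^ 2 + (Real.cos θ : ℂ) ^ 2 = 1 := by
      exact_mod_cast Real.sin_sq_add_cos_sq θ
    have h' : (Real.sin θ : ℂ) ^ 2 = 1 - (Real.cos θ : ℂ) ^ 2 := by linear_combination h
    simp only [pow_add, h']
    linear_combination (-(Complex.exp (Complex.I * (s * Real.cos θ : ℝ)) * (Real.cos θ : ℂ) ^ 2 *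
      (Real.sin θ : ℂ) ^ k)) * Complex.I_sq
  · exact (by fun_prop : Continuous _).intervalIntegrable _ _
  · exact (by fun_prop : Continuous _).intervalIntegrable _ _

/-- The function `exp (i s cos θ) sin θ ^ (k+1)` vanishes at `0` and `π`, so its derivative
integrates to zero. Together with the formula for the second derivative this is Bessel's equation.
-/
theorem besselIntegralDeriv_eq (k : ℕ) (s : ℝ) :
    (k + 1 : ℂ) * besselIntegralDeriv k s = -(s * besselIntegral (k + 2) s) := by
  have hd : ∀ θ : ℝ, HasDerivAt
      (fun θ : ℝ => Complex.exp (Complex.I * (s * Real.cos θ : ℝ)) * (Real.sin θ : ℂ) ^ (k + 1))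
      (-(Complex.I * s) * (Complex.exp (Complex.I * (s * Real.cos θ : ℝ)) *
          (Real.sin θ : ℂ) ^ (k + 2)) + -(Complex.I * (k + 1)) *
        (Complex.exp (Complex.I * (s * Real.cos θ : ℝ)) *
          (Complex.I * Real.cos θ * (Real.sin θ : ℂ) ^ k))) θ := by
    intro θ
    have h1 : HasDerivAt (fun θ : ℝ => Complex.I * ((s * Real.cos θ : ℝ) : ℂ))
        (Complex.I * ((s * (-Real.sin θ) : ℝ) : ℂ)) θ :=
      (((Real.hasDerivAt_cos θ).const_mul s).ofReal_comp).const_mul Complex.I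
    have h2 : HasDerivAt (fun θ : ℝ => (Real.sin θ : ℂ) ^ (k + 1))
        (((k + 1 : ℕ) : ℂ) * (Real.sin θ : ℂ) ^ k * (Real.cos θ : ℂ)) θ :=
      ((Real.hasDerivAt_sin θ).ofReal_comp).pow (k + 1)
    convert! h1.cexp.mul h2 using 1
    push_cast
    linear_combination (-(Complex.exp (Complex.I * (s * Complex.cos θ)) * (k + 1) *
      Complex.cos θ * (Complex.sin θ) ^ k)) * Complex.I_sq
  have hi := intervalIntegral.integral_eq_sub_of_hasDerivAt (a := 0) (b := Real.pi)
    (fun θ _ => hd θ) ((by fun_prop : Continuous _).intervalIntegrable _ _)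
  rw [intervalIntegral.integral_add ((by fun_prop : Continuous _).intervalIntegrable _ _)
    ((by fun_prop : Continuous _).intervalIntegrable _ _),
    intervalIntegral.integral_const_mul, intervalIntegral.integral_const_mul] at hi
  simp only [Real.sin_pi, Real.sin_zero, Complex.ofReal_zero, ne_eq, Nat.succ_ne_zero,
    not_false_eq_true, zero_pow, mul_zero, sub_self] at hi
  change -(Complex.I * s) * besselIntegral (k + 2) s +
    -(Complex.I * (k + 1)) * besselIntegralDeriv k s = 0 at hi
  linear_combination (Complex.I) * hi + ((k + 1 : ℂ) * besselIntegralDeriv k s +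
    (s * besselIntegral (k + 2) s)) * Complex.I_sq

theorem norm_besselIntegral_le (k : ℕ) (s : ℝ) : ‖besselIntegral k s‖ ≤ Real.pi := by
  have := intervalIntegral.norm_integral_le_of_norm_le_const (a := 0) (b := Real.pi) (C := 1)
    (f := fun θ => Complex.exp (Complex.I * (s * Real.cos θ : ℝ)) * (Real.sin θ : ℂ) ^ k) ?_
  · rwa [one_mul, sub_zero, abs_of_pos Real.pi_pos] at this
  · intro θ _
    rw [norm_mul, Complex.norm_exp_I_mul_ofReal, one_mul, norm_pow, Complex.norm_real]
    exact pow_le_one₀ (norm_nonneg _) (Real.abs_sin_le_one θ)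

/-- Differentiating in the radius passes from balls to spheres: the transform of a ball in dimension
`k + 2` involves index `k + 2`, that of its boundary sphere index `k`. -/
theorem hasDerivAt_pow_mul_besselIntegral (k : ℕ) (s : ℝ) :
    HasDerivAt (fun s : ℝ => (s : ℂ) ^ (k + 2) * besselIntegral (k + 2) s)
      ((k + 1) * (s : ℂ) ^ (k + 1) * besselIntegral k s) s := by
  have heq : (fun s : ℝ => (s : ℂ) ^ (k + 2) * besselIntegral (k + 2) s) =
      fun s : ℝ => -(k + 1 : ℂ) * ((s : ℂ) ^ (k + 1) * besselIntegralDeriv k s) := by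
    funext s
    linear_combination ((s : ℂ) ^ (k + 1)) * besselIntegralDeriv_eq k s
  rw [heq]
  have h1 : HasDerivAt (fun s : ℝ => (s : ℂ) ^ (k + 1)) (((k + 1 : ℕ) : ℂ) * (s : ℂ) ^ k) s := by
    convert! ((hasDerivAt_id s).ofReal_comp).pow (k + 1) using 1
    simp
  convert! (h1.mul (hasDerivAt_besselIntegralDeriv k s)).const_mul (-(k + 1 : ℂ)) using 1
  push_cast
  linear_combination ((k + 1 : ℂ) * (s : ℂ) ^ k) * besselIntegralDeriv_eq k s

/-- A bounded-energy estimate for solutions of `u'' = (q / s² - 1) u`. -/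
theorem exists_bound_of_perturbed_oscillator {F : Type*} [NormedAddCommGroup F]
    [InnerProductSpace ℝ F] {u w : ℝ → F} (q : ℝ)
    (hu : ∀ s, 0 < s → HasDerivAt u (w s) s)
    (hw : ∀ s, 0 < s → HasDerivAt w ((q / s ^ 2 - 1) • u s) s) :
    ∃ C, ∀ s, 1 ≤ s → ‖u s‖ ≤ C := by
  set E : ℝ → ℝ := fun s => ‖u s‖ ^ 2 + ‖w s‖ ^ 2 with hE
  have hEd : ∀ s, 0 < s → HasDerivAt E (q / s ^ 2 * (2 * inner ℝ (u s) (w s))) s := by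
    intro s hs
    convert! (hu s hs).norm_sq.add (hw s hs).norm_sq using 1
    rw [inner_smul_right, real_inner_comm]
    ring
  have hGd : ∀ s, 0 < s → HasDerivAt (fun s => E s * Real.exp (|q| / s))
      (q / s ^ 2 * (2 * inner ℝ (u s) (w s)) * Real.exp (|q| / s) +
        E s * (Real.exp (|q| / s) * (-|q| / s ^ 2))) s := by
    intro s hs
    refine (hEd s hs).mul ?_
    have := (((hasDerivAt_inv hs.ne').const_mul |q|)).exp
    convert! this using 1
    rw [div_eq_mul_inv]; ring
  -- The energy satisfies `|E'| ≤ |q| s⁻² E`. The factor `exp (|q|/s)` has logarithmic derivative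
  -- `-|q|/s²`, which absorbs this growth, and it stays bounded on `[1, ∞)`.
  have hanti : AntitoneOn (fun s => E s * Real.exp (|q| / s)) (Set.Ici 1) := by
    refine antitoneOn_of_deriv_nonpos (convex_Ici 1) ?_ ?_ ?_
    · exact fun s hs => (hGd s (lt_of_lt_of_le one_pos hs)).continuousAt.continuousWithinAt
    · intro s hs
      rw [interior_Ici] at hs
      exact (hGd s (one_pos.trans hs)).differentiableAt.differentiableWithinAt
    · intro s hs
      rw [interior_Ici] at hs
      have hs0 : 0 < s := one_pos.trans hs
      rw [(hGd s hs0).deriv]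
      have h1 : |inner ℝ (u s) (w s)| ≤ ‖u s‖ * ‖w s‖ := abs_real_inner_le_norm _ _
      have h2 : q * (2 * inner ℝ (u s) (w s)) ≤ |q| * E s := by
        calc q * (2 * inner ℝ (u s) (w s)) ≤ |q * (2 * inner ℝ (u s) (w s))| := le_abs_self _
          _ = |q| * (2 * |inner ℝ (u s) (w s)|) := by
            rw [abs_mul, abs_mul, abs_of_pos (by norm_num : (0 : ℝ) < 2)]
          _ ≤ |q| * E s := by
            refine mul_le_mul_of_nonneg_left ?_ (abs_nonneg q)
            simp only [hE]
            nlinarith [sq_nonneg (‖u s‖ - ‖w s‖)]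
      have h3 : q / s ^ 2 * (2 * inner ℝ (u s) (w s)) * Real.exp (|q| / s) +
          E s * (Real.exp (|q| / s) * (-|q| / s ^ 2)) =
          (Real.exp (|q| / s) / s ^ 2) * (q * (2 * inner ℝ (u s) (w s)) - |q| * E s) := by
        field_simp
        ring
      rw [h3]
      exact mul_nonpos_of_nonneg_of_nonpos (by positivity) (by linarith)
  refine ⟨Real.sqrt (E 1 * Real.exp |q|), fun s hs => Real.le_sqrt_of_sq_le ?_⟩
  have h := hanti (Set.mem_Ici.2 le_rfl) (Set.mem_Ici.2 hs) hs
  simp only [div_one] at h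
  have hs0 : 0 < s := one_pos.trans_le hs
  have h1 : 1 ≤ Real.exp (|q| / s) := Real.one_le_exp (by positivity)
  have h0 : ‖u s‖ ^ 2 ≤ E s := by simp only [hE]; linarith [sq_nonneg ‖w s‖]
  have h4 : 0 ≤ E s := by positivity
  nlinarith

/-- Multiplying by `s ^ p`, `p = (k+1)/2`, removes the first-order term of Bessel's equation and
leaves `u'' = (p(p-1)/s² - 1) u`, whose solutions are bounded for `s ≥ 1`. For `s ≤ 1` the trivial
bound `π` suffices. -/
theorem exists_norm_besselIntegral_le_rpow (k : ℕ) :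
    ∃ C, 0 ≤ C ∧ ∀ s : ℝ, 0 < s → ‖besselIntegral k s‖ ≤ C * s ^ (-((k + 1 : ℝ) / 2)) := by
  set p : ℝ := (k + 1 : ℝ) / 2 with hp
  have hp0 : 0 ≤ p := by positivity
  have hrp : ∀ (a : ℝ) (s : ℝ), 0 < s →
      HasDerivAt (fun s : ℝ => s ^ a) (a * s ^ (a - 1)) s := fun a s hs =>
    Real.hasDerivAt_rpow_const (Or.inl hs.ne')
  obtain ⟨C, hC⟩ := exists_bound_of_perturbed_oscillator (p * (p - 1))
    (u := fun s : ℝ => (s ^ p) • besselIntegral k s)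
    (w := fun s : ℝ => s ^ p • besselIntegralDeriv k s + (p * s ^ (p - 1)) • besselIntegral k s)
    (fun s hs => (hrp p s hs).smul (hasDerivAt_besselIntegral k s)) (by
      intro s hs
      convert! ((hrp p s hs).smul (hasDerivAt_besselIntegralDeriv k s)).add
        (((hrp (p - 1) s hs).const_mul p).smul (hasDerivAt_besselIntegral k s)) using 1
      have h1 : s ^ (p - 1) = s ^ p / s := Real.rpow_sub_one hs.ne' p
      have h2 : s ^ (p - 1 - 1) = s ^ p / s / s := by
        rw [Real.rpow_sub_one hs.ne' (p - 1), h1]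
      have h3 : besselIntegral (k + 2) s = -((2 * p / s : ℝ) : ℂ) * besselIntegralDeriv k s := by
        have := besselIntegralDeriv_eq k s
        have hs' : (s : ℂ) ≠ 0 := by exact_mod_cast hs.ne'
        rw [hp]
        push_cast
        field_simp
        linear_combination this
      rw [h2, h1, h3]
      simp only [Complex.real_smul]
      have hs' : (s : ℂ) ≠ 0 := by exact_mod_cast hs.ne'
      push_cast
      field_simp
      ring)
  refine ⟨max C Real.pi, le_max_of_le_right Real.pi_pos.le, fun s hs => ?_⟩
  rcases le_total 1 s with h | h
  · have := hC s h
    rw [norm_smul, Real.norm_of_nonneg (by positivity)] at this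
    rw [Real.rpow_neg hs.le, ← div_eq_mul_inv, le_div_iff₀ (by positivity), mul_comm]
    exact this.trans (le_max_left _ _)
  · refine (norm_besselIntegral_le k s).trans ?_
    have h1 : 1 ≤ s ^ (-p) := Real.one_le_rpow_of_pos_of_le_one_of_nonpos hs h (by linarith)
    nlinarith [le_max_right C Real.pi, Real.pi_pos]

/-! ### Fourier transforms of balls and annuli. -/

/-- The splitting `ℝ × ℝ^n → ℝ^(n+1)`. -/
def euclideanCons (n : ℕ) (z : ℝ × EuclideanSpace ℝ (Fin n)) : EuclideanSpace ℝ (Fin (n + 1)) :=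
  WithLp.toLp 2 (Fin.insertNth 0 z.1 (WithLp.ofLp z.2))

theorem measurePreserving_euclideanCons (n : ℕ) :
    MeasurePreserving (euclideanCons n) volume volume := by
  have h1 : MeasurePreserving
      (Prod.map id (WithLp.ofLp : EuclideanSpace ℝ (Fin n) → Fin n → ℝ)) (volume.prod volume)
      ((volume : Measure ℝ).prod volume) :=
    (MeasurePreserving.id volume).prod (PiLp.volume_preserving_ofLp (Fin n))
  have h2 := (volume_preserving_piFinSuccAbove (fun _ : Fin (n + 1) => ℝ) 0).symm
  exact ((PiLp.volume_preserving_toLp (Fin (n + 1))).comp h2).comp h1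

theorem norm_sq_euclideanCons (n : ℕ) (z : ℝ × EuclideanSpace ℝ (Fin n)) :
    ‖euclideanCons n z‖ ^ 2 = z.1 ^ 2 + ‖z.2‖ ^ 2 := by
  rw [EuclideanSpace.norm_sq_eq, Fin.sum_univ_succ, EuclideanSpace.norm_sq_eq]
  simp [euclideanCons]

theorem euclideanCons_zero (n : ℕ) (z : ℝ × EuclideanSpace ℝ (Fin n)) :
    euclideanCons n z 0 = z.1 := by
  simp [euclideanCons]

theorem setIntegral_ball_comp_coord (n : ℕ) {R : ℝ} (hR : 0 < R) {f : ℝ → ℂ} (hf : Continuous f) :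
    ∫ x in Metric.ball (0 : EuclideanSpace ℝ (Fin (n + 1))) R, f (x 0) =
      ∫ t in -R..R, f t * ((volume.real (Metric.ball (0 : EuclideanSpace ℝ (Fin n)) 1) *
        Real.sqrt (R ^ 2 - t ^ 2) ^ n : ℝ) : ℂ) := by
  set F : EuclideanSpace ℝ (Fin (n + 1)) → ℂ :=
    (Metric.ball (0 : EuclideanSpace ℝ (Fin (n + 1))) R).indicator fun x => f (x 0) with hF
  have hmeas : MeasurableSet (Metric.ball (0 : EuclideanSpace ℝ (Fin (n + 1))) R) :=
    measurableSet_ball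
  have hcont : Continuous fun x : EuclideanSpace ℝ (Fin (n + 1)) => f (x 0) := by fun_prop
  have hFi : Integrable F := by
    rw [hF, integrable_indicator_iff hmeas]
    exact (hcont.locallyIntegrable.integrableOn_isCompact
      (isCompact_closedBall 0 R)).mono_set Metric.ball_subset_closedBall
  have hmp := measurePreserving_euclideanCons n
  rw [← integral_indicator hmeas, ← hF]
  have h1 : ∫ x, F x = ∫ z : ℝ × EuclideanSpace ℝ (Fin n), F (euclideanCons n z) := by
    rw [← hmp.map_eq, integral_map hmp.measurable.aemeasurable]
    rw [hmp.map_eq]; exact hFi.aestronglyMeasurable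
  have h2 : Integrable (fun z : ℝ × EuclideanSpace ℝ (Fin n) => F (euclideanCons n z))
      (volume.prod volume) := (hmp.integrable_comp hFi.aestronglyMeasurable).2 hFi
  rw [h1, Measure.volume_eq_prod, integral_prod _ h2, intervalIntegral.integral_of_le (by linarith),
    integral_Ioc_eq_integral_Ioo, ← integral_indicator measurableSet_Ioo]
  refine integral_congr_ae (Filter.Eventually.of_forall fun t => ?_)
  have hmem : ∀ y : EuclideanSpace ℝ (Fin n),
      euclideanCons n (t, y) ∈ Metric.ball (0 : EuclideanSpace ℝ (Fin (n + 1))) R ↔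
        t ^ 2 + ‖y‖ ^ 2 < R ^ 2 := by
    intro y
    rw [mem_ball_zero_iff, ← norm_sq_euclideanCons n (t, y)]
    exact (sq_lt_sq₀ (norm_nonneg _) hR.le).symm
  by_cases ht : t ∈ Set.Ioo (-R) R
  · have hpos : 0 < R ^ 2 - t ^ 2 := by nlinarith [ht.1, ht.2]
    have hset : (fun y : EuclideanSpace ℝ (Fin n) => F (euclideanCons n (t, y))) =
        (Metric.ball (0 : EuclideanSpace ℝ (Fin n)) (Real.sqrt (R ^ 2 - t ^ 2))).indicator
          fun _ => f t := by
      funext y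
      have : euclideanCons n (t, y) ∈ Metric.ball (0 : EuclideanSpace ℝ (Fin (n + 1))) R ↔
          y ∈ Metric.ball (0 : EuclideanSpace ℝ (Fin n)) (Real.sqrt (R ^ 2 - t ^ 2)) := by
        rw [hmem, mem_ball_zero_iff, Real.lt_sqrt (norm_nonneg _)]
        constructor <;> intro h <;> linarith
      by_cases hy : y ∈ Metric.ball (0 : EuclideanSpace ℝ (Fin n)) (Real.sqrt (R ^ 2 - t ^ 2))
      · rw [hF, Set.indicator_of_mem hy, Set.indicator_of_mem (this.2 hy), euclideanCons_zero]
      · rw [hF, Set.indicator_of_notMem hy, Set.indicator_of_notMem (mt this.1 hy)]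
    simp only [hset]
    rw [Set.indicator_of_mem ht, integral_indicator measurableSet_ball, setIntegral_const,
      measureReal_def, Measure.addHaar_ball_of_pos _ _ (Real.sqrt_pos.2 hpos),
      finrank_euclideanSpace_fin, ENNReal.toReal_mul, ENNReal.toReal_ofReal (by positivity),
      Complex.real_smul, measureReal_def]
    push_cast; ring
  · rw [Set.indicator_of_notMem ht]
    refine integral_eq_zero_of_ae (Filter.Eventually.of_forall fun y => ?_)
    refine Set.indicator_of_notMem ?_ _
    rw [hmem]
    intro h
    refine ht (abs_lt.1 (abs_lt_of_sq_lt_sq (by nlinarith [sq_nonneg ‖y‖]) hR.le))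

/-- A reflection turns `ξ` into a multiple of the first basis vector, and the ball is then sliced
along that axis. Under `t = R cos θ` the slices give `sin θ ^ n` and the differential one more
factor of `sin θ`. -/
theorem charFun_restrict_ball (n : ℕ) {R : ℝ} (hR : 0 < R)
    (ξ : EuclideanSpace ℝ (Fin (n + 1))) :
    charFun (volume.restrict (Metric.ball (0 : EuclideanSpace ℝ (Fin (n + 1))) R)) ξ =
      volume.real (Metric.ball (0 : EuclideanSpace ℝ (Fin n)) 1) * R ^ (n + 1) *
        besselIntegral (n + 1) (R * ‖ξ‖) := by
  set w : EuclideanSpace ℝ (Fin (n + 1)) := EuclideanSpace.single 0 ‖ξ‖ with hw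
  have hnorm : ‖ξ‖ = ‖w‖ := by simp [hw]
  set T := (Submodule.span ℝ {ξ - w})ᗮ.reflection with hT
  have hTξ : T ξ = w := Submodule.reflection_sub hnorm
  have hTm : MeasurePreserving T volume volume := T.measurePreserving
  have hball : T ⁻¹' Metric.ball 0 R = Metric.ball 0 R := by
    ext x; simp
  have h1 : charFun (volume.restrict (Metric.ball (0 : EuclideanSpace ℝ (Fin (n + 1))) R)) ξ =
      ∫ x in Metric.ball (0 : EuclideanSpace ℝ (Fin (n + 1))) R,
        Complex.exp ((‖ξ‖ * x 0 : ℝ) * Complex.I) := by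
    rw [charFun_apply, ← hTm.setIntegral_preimage_emb T.toHomeomorph.measurableEmbedding
      (fun x => Complex.exp ((‖ξ‖ * x 0 : ℝ) * Complex.I)), hball]
    refine integral_congr_ae (Filter.Eventually.of_forall fun x => ?_)
    have : inner ℝ x ξ = ‖ξ‖ * (T x) 0 := by
      rw [← T.inner_map_map x ξ, hTξ, hw, EuclideanSpace.inner_single_right]
      simp
    simp only [this]
  rw [h1, setIntegral_ball_comp_coord n hR
    (f := fun t => Complex.exp ((‖ξ‖ * t : ℝ) * Complex.I)) (by fun_prop)]
  set v := volume.real (Metric.ball (0 : EuclideanSpace ℝ (Fin n)) 1)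
  have hsub := intervalIntegral.integral_deriv_smul_comp (a := 0) (b := Real.pi)
    (f := fun θ => R * Real.cos θ) (f' := fun θ => R * (-Real.sin θ))
    (g := fun t => Complex.exp ((‖ξ‖ * t : ℝ) * Complex.I) *
      ((v * Real.sqrt (R ^ 2 - t ^ 2) ^ n : ℝ) : ℂ))
    (fun θ _ => (Real.hasDerivAt_cos θ).const_mul R) (by fun_prop) (by fun_prop)
  simp only [Real.cos_zero, mul_one, Real.cos_pi, mul_neg] at hsub
  rw [intervalIntegral.integral_symm, ← hsub, ← intervalIntegral.integral_neg, besselIntegral,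
    waveIntegral, ← intervalIntegral.integral_const_mul]
  refine intervalIntegral.integral_congr fun θ hθ => ?_
  rw [Set.uIcc_of_le Real.pi_pos.le] at hθ
  have hsqrt : Real.sqrt (R ^ 2 - (R * Real.cos θ) ^ 2) = R * Real.sin θ := by
    have hsin := Real.sin_nonneg_of_mem_Icc hθ
    rw [show R ^ 2 - (R * Real.cos θ) ^ 2 = (R * Real.sin θ) ^ 2 by
      rw [mul_pow, mul_pow, Real.sin_sq]; ring]
    exact Real.sqrt_sq (by positivity)
  simp only [Function.comp_apply, hsqrt, Complex.real_smul]
  rw [show Complex.I * ((R * ‖ξ‖ * Real.cos θ : ℝ) : ℂ) =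
    ((‖ξ‖ * (R * Real.cos θ) : ℝ) : ℂ) * Complex.I by push_cast; ring]
  push_cast
  ring

/-- The annulus `1 - δ ≤ |x| < 1 + δ`. -/
def annulus (d : ℕ) (δ : ℝ) : Set (EuclideanSpace ℝ (Fin d)) :=
  Metric.ball 0 (1 + δ) \ Metric.ball 0 (1 - δ)

theorem volume_real_annulus_le (n : ℕ) {δ : ℝ} (h0 : 0 ≤ δ) (h1 : δ < 1) :
    volume.real (annulus (n + 1) δ) ≤
      volume.real (Metric.ball (0 : EuclideanSpace ℝ (Fin (n + 1))) 1) * ((n + 1) * 2 ^ (n + 1)) *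
        δ := by
  have hv : ∀ r : ℝ, 0 < r → volume.real (Metric.ball (0 : EuclideanSpace ℝ (Fin (n + 1))) r) =
      r ^ (n + 1) * volume.real (Metric.ball (0 : EuclideanSpace ℝ (Fin (n + 1))) 1) := by
    intro r hr
    rw [measureReal_def, Measure.addHaar_ball_of_pos _ _ hr,
      finrank_euclideanSpace_fin, ENNReal.toReal_mul, ENNReal.toReal_ofReal (by positivity),
      measureReal_def]
  rw [annulus, measureReal_sdiff (Metric.ball_subset_ball (by linarith)) measurableSet_ball
    measure_ball_lt_top.ne, hv (1 + δ) (by linarith), hv (1 - δ) (by linarith), ← sub_mul, mul_comm,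
    mul_assoc]
  refine mul_le_mul_of_nonneg_left ?_ measureReal_nonneg
  have h := abs_pow_sub_pow_le (1 + δ) (1 - δ) (n + 1)
  have hm : max |1 + δ| |1 - δ| ≤ 2 :=
    max_le (abs_le.2 ⟨by linarith, by linarith⟩) (abs_le.2 ⟨by linarith, by linarith⟩)
  have hm' : max |1 + δ| |1 - δ| ^ (n + 1 - 1) ≤ 2 ^ n :=
    pow_le_pow_left₀ (le_max_of_le_left (abs_nonneg _)) hm n
  rw [show 1 + δ - (1 - δ) = 2 * δ by ring, abs_of_nonneg (by positivity : 0 ≤ 2 * δ)] at h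
  calc (1 + δ) ^ (n + 1) - (1 - δ) ^ (n + 1) ≤ _ := le_abs_self _
    _ ≤ _ := h
    _ ≤ 2 * δ * ((n + 1 : ℕ) : ℝ) * 2 ^ n := by gcongr
    _ = _ := by push_cast; ring

theorem volume_annulus_lt_top (d : ℕ) (δ : ℝ) : volume (annulus d δ) < ⊤ :=
  (measure_mono Set.sdiff_subset).trans_lt measure_ball_lt_top

theorem exists_norm_charFun_annulus_le (n : ℕ) :
    ∃ C, 0 ≤ C ∧ ∀ δ, 0 ≤ δ → δ < 1 → ∀ ξ : EuclideanSpace ℝ (Fin (n + 1)),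
      ‖charFun (volume.restrict (annulus (n + 1) δ)) ξ‖ ≤ C * δ := by
  refine ⟨volume.real (Metric.ball (0 : EuclideanSpace ℝ (Fin (n + 1))) 1) *
    ((n + 1) * 2 ^ (n + 1)), by positivity, fun δ h0 h1 ξ => ?_⟩
  refine le_trans ?_ (volume_real_annulus_le n h0 h1)
  have : IsFiniteMeasure (volume.restrict (annulus (n + 1) δ)) :=
    isFiniteMeasure_restrict.2 (volume_annulus_lt_top _ _).ne
  simpa using norm_charFun_le (μ := volume.restrict (annulus (n + 1) δ)) ξ

/-- With `r = ‖ξ‖`, the transform is `r^(-(k+2))` times the increment of `P` over an interval of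
length `2δr`, on which `|P'| ≲ r^((k+1)/2)`. The mean value inequality gives `δ r^(-(k+1)/2)`,
uniformly in `δ`. In dimension one no decay is claimed. -/
theorem exists_norm_charFun_annulus_le_rpow (n : ℕ) :
    ∃ C, 0 ≤ C ∧ ∀ δ, 0 ≤ δ → δ < 1 → ∀ ξ : EuclideanSpace ℝ (Fin (n + 1)), ξ ≠ 0 →
      ‖charFun (volume.restrict (annulus (n + 1) δ)) ξ‖ ≤ C * δ * ‖ξ‖ ^ (-(n / 2 : ℝ)) := by
  rcases n with _ | k
  · obtain ⟨C, hC, h⟩ := exists_norm_charFun_annulus_le 0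
    exact ⟨C, hC, fun δ h0 h1 ξ _ => by simpa using h δ h0 h1 ξ⟩
  obtain ⟨C, hC, hB⟩ := exists_norm_besselIntegral_le_rpow k
  set v := volume.real (Metric.ball (0 : EuclideanSpace ℝ (Fin (k + 1))) 1)
  refine ⟨v * ((k + 1) * C * 2 ^ ((k + 1 : ℝ) / 2) * 2), by positivity, fun δ h0 h1 ξ hξ => ?_⟩
  set r := ‖ξ‖ with hr
  have hr0 : 0 < r := norm_pos_iff.2 hξ
  set P : ℝ → ℂ := fun s => (s : ℂ) ^ (k + 2) * besselIntegral (k + 2) s with hP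
  have hsplit : charFun (volume.restrict (annulus (k + 2) δ)) ξ =
      v * (r : ℂ)⁻¹ ^ (k + 2) * (P ((1 + δ) * r) - P ((1 - δ) * r)) := by
    have hint : IntegrableOn (fun x : EuclideanSpace ℝ (Fin (k + 2)) =>
        Complex.exp (inner ℝ x ξ * Complex.I)) (Metric.ball 0 (1 + δ)) :=
      ((by fun_prop : Continuous _).locallyIntegrable.integrableOn_isCompact
        (isCompact_closedBall 0 (1 + δ))).mono_set Metric.ball_subset_closedBall
    have h2 := setIntegral_sdiff (μ := volume) (measurableSet_ball) hint
      (Metric.ball_subset_ball (by linarith : 1 - δ ≤ 1 + δ))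
    have h3 := charFun_restrict_ball (k + 1) (by linarith : 0 < 1 + δ) ξ
    have h4 := charFun_restrict_ball (k + 1) (by linarith : 0 < 1 - δ) ξ
    have hr' : (r : ℂ) ≠ 0 := by exact_mod_cast hr0.ne'
    have hpow : ∀ a : ℂ, a ^ (k + 2) = (r : ℂ)⁻¹ ^ (k + 2) * (a * r) ^ (k + 2) := by
      intro a
      rw [← mul_pow]
      congr 1
      field_simp
    rw [charFun_apply, ← hr, hpow] at h3 h4
    rw [charFun_apply, annulus, h2, h3, h4, hP]
    push_cast
    ring
  have hderiv : ∀ s ∈ Set.Icc ((1 - δ) * r) ((1 + δ) * r),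
      HasDerivWithinAt P ((k + 1) * (s : ℂ) ^ (k + 1) * besselIntegral k s)
        (Set.Icc ((1 - δ) * r) ((1 + δ) * r)) s :=
    fun s _ => (hasDerivAt_pow_mul_besselIntegral k s).hasDerivWithinAt
  have hbd : ∀ s ∈ Set.Icc ((1 - δ) * r) ((1 + δ) * r),
      ‖(k + 1) * (s : ℂ) ^ (k + 1) * besselIntegral k s‖ ≤
        (k + 1) * C * (2 * r) ^ ((k + 1 : ℝ) / 2) := by
    intro s hs
    have hs0 : 0 < s := lt_of_lt_of_le (mul_pos (by linarith) hr0) hs.1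
    have hs2 : s ≤ 2 * r := hs.2.trans (by nlinarith)
    have h5 : ‖(k + 1 : ℂ)‖ = k + 1 := by
      have := Complex.norm_natCast (k + 1)
      push_cast at this
      exact this
    rw [norm_mul, norm_mul, norm_pow, h5, Complex.norm_real, Real.norm_of_nonneg hs0.le]
    calc (k + 1) * s ^ (k + 1) * ‖besselIntegral k s‖
        ≤ (k + 1) * s ^ (k + 1) * (C * s ^ (-((k + 1 : ℝ) / 2))) := by
          gcongr; exact hB s hs0
      _ = (k + 1) * C * s ^ ((k + 1 : ℝ) / 2) := by
          have : s ^ (k + 1) * s ^ (-((k + 1 : ℝ) / 2)) = s ^ ((k + 1 : ℝ) / 2) := by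
            rw [← Real.rpow_natCast, ← Real.rpow_add hs0]
            congr 1; push_cast; ring
          rw [← this]; ring
      _ ≤ _ := by gcongr
  have hmv := (convex_Icc ((1 - δ) * r) ((1 + δ) * r)).norm_image_sub_le_of_norm_hasDerivWithin_le
    hderiv hbd (Set.left_mem_Icc.2 (by nlinarith)) (Set.right_mem_Icc.2 (by nlinarith))
  rw [show (1 + δ) * r - (1 - δ) * r = 2 * δ * r by ring,
    Real.norm_of_nonneg (by positivity)] at hmv
  rw [hsplit, norm_mul, norm_mul, norm_pow, norm_inv, Complex.norm_real, Complex.norm_real,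
    Real.norm_of_nonneg hr0.le, Real.norm_of_nonneg measureReal_nonneg]
  calc v * r⁻¹ ^ (k + 2) * ‖P ((1 + δ) * r) - P ((1 - δ) * r)‖
      ≤ v * r⁻¹ ^ (k + 2) * ((k + 1) * C * (2 * r) ^ ((k + 1 : ℝ) / 2) * (2 * δ * r)) := by
        gcongr
    _ = _ := by
        rw [Real.mul_rpow (by norm_num) hr0.le]
        have : r⁻¹ ^ (k + 2) * r ^ ((k + 1 : ℝ) / 2) * r = r ^ (-(((k + 1 : ℕ) : ℝ) / 2)) := by
          rw [inv_pow, ← Real.rpow_natCast r (k + 2), ← Real.rpow_neg hr0.le, ← Real.rpow_add hr0]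
          nth_rw 2 [← Real.rpow_one r]
          rw [← Real.rpow_add hr0]
          congr 1; push_cast; ring
        rw [← this]; ring

/-! ### Gaussian energies on the Fourier side. -/

section Gaussian

variable {V : Type*} [NormedAddCommGroup V] [InnerProductSpace ℝ V] [FiniteDimensional ℝ V]
  [MeasurableSpace V] [BorelSpace V]

theorem integrable_exp_neg_norm_sq {c : ℝ} (hc : 0 < c) :
    Integrable (fun ξ : V => Real.exp (-c * ‖ξ‖ ^ 2)) := by
  have h := (GaussianFourier.integrable_cexp_neg_mul_sq_norm_add (V := V) (b := (c : ℂ))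
    (by simpa using hc) 0 0).re
  refine h.congr (Filter.Eventually.of_forall fun ξ => ?_)
  have : (-(c : ℂ) * (‖ξ‖ : ℂ) ^ 2 + 0 * ((inner ℝ (0 : V) ξ : ℝ) : ℂ)) =
      ((-c * ‖ξ‖ ^ 2 : ℝ) : ℂ) := by push_cast; ring
  simp only [this]
  rw [← Complex.ofReal_exp]
  exact Complex.ofReal_re _

/-- Parseval's identity for a Gaussian test function: the Gaussian is the transform of a Gaussian,
and Fubini exchanges the integrals. -/
theorem integral_gaussian_eq_integral_charFun (ρ : Measure V) [IsFiniteMeasure ρ] {b : ℝ}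
    (hb : 0 < b) :
    (((4 * Real.pi * b) ^ (Module.finrank ℝ V / 2 : ℝ) : ℝ) : ℂ) *
        ((∫ w, Real.exp (-b * ‖w‖ ^ 2) ∂ρ : ℝ) : ℂ) =
      ∫ ξ : V, (Real.exp (-(4 * b)⁻¹ * ‖ξ‖ ^ 2) : ℂ) * charFun ρ ξ := by
  have hinner : ∀ w : V, ∫ ξ : V, (Real.exp (-(4 * b)⁻¹ * ‖ξ‖ ^ 2) : ℂ) *
      Complex.exp (inner ℝ w ξ * Complex.I) =
      (((4 * Real.pi * b) ^ (Module.finrank ℝ V / 2 : ℝ) : ℝ) : ℂ) *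
        (Real.exp (-b * ‖w‖ ^ 2) : ℂ) := by
    intro w
    have h := GaussianFourier.integral_cexp_neg_mul_sq_norm_add (V := V)
      (b := (((4 * b)⁻¹ : ℝ) : ℂ)) (by rw [Complex.ofReal_re]; positivity) Complex.I w
    convert! h using 2
    · funext ξ
      rw [Complex.ofReal_exp, ← Complex.exp_add]
      congr 1
      push_cast
      ring
    · rw [← Complex.ofReal_div, Complex.ofReal_cpow (by positivity)]
      push_cast
      congr 1
      field_simp
    · rw [Complex.I_sq, Complex.ofReal_exp]
      congr 1
      push_cast
      have : (b : ℂ) ≠ 0 := by exact_mod_cast hb.ne'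
      field_simp
  have hint : Integrable (fun p : V × V => (Real.exp (-(4 * b)⁻¹ * ‖p.1‖ ^ 2) : ℂ) *
      Complex.exp (inner ℝ p.2 p.1 * Complex.I)) (volume.prod ρ) := by
    have h1 : Integrable (fun p : V × V => Real.exp (-(4 * b)⁻¹ * ‖p.1‖ ^ 2) * (1 : ℝ))
        (volume.prod ρ) :=
      (integrable_exp_neg_norm_sq (V := V) (by positivity)).mul_prod (integrable_const (1 : ℝ))
    refine h1.mono (by fun_prop) (Filter.Eventually.of_forall fun p => ?_)
    rw [norm_mul, norm_mul, Complex.norm_exp_ofReal_mul_I, Complex.norm_real, norm_one]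
  calc _ = ∫ w, ∫ ξ : V, (Real.exp (-(4 * b)⁻¹ * ‖ξ‖ ^ 2) : ℂ) *
      Complex.exp (inner ℝ w ξ * Complex.I) ∂volume ∂ρ := by
        simp only [hinner]
        rw [integral_const_mul, ← integral_complex_ofReal]
    _ = ∫ ξ : V, ∫ w, (Real.exp (-(4 * b)⁻¹ * ‖ξ‖ ^ 2) : ℂ) *
      Complex.exp (inner ℝ w ξ * Complex.I) ∂ρ := (integral_integral_swap hint).symm
    _ = _ := by
        refine integral_congr_ae (Filter.Eventually.of_forall fun ξ => ?_)
        simp only [charFun_apply, integral_const_mul]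

/-- The distribution of `x - y` under `μ × μ`. -/
def diffMeasure (μ : Measure V) : Measure V :=
  Measure.conv μ (μ.map fun x => (-1 : ℝ) • x)

instance (μ : Measure V) [IsFiniteMeasure μ] : IsFiniteMeasure (diffMeasure μ) := by
  unfold diffMeasure; infer_instance

theorem charFun_diffMeasure (μ : Measure V) [IsFiniteMeasure μ] (ξ : V) :
    charFun (diffMeasure μ) ξ = ((‖charFun μ ξ‖ ^ 2 : ℝ) : ℂ) := by
  rw [diffMeasure, charFun_conv, charFun_map_smul, neg_one_smul, charFun_neg, Complex.mul_conj,
    Complex.normSq_eq_norm_sq]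

theorem lintegral_diffMeasure (μ : Measure V) [IsFiniteMeasure μ] {f : V → ℝ≥0∞}
    (hf : Measurable f) :
    ∫⁻ w, f w ∂(diffMeasure μ) = ∫⁻ x, ∫⁻ y, f (x - y) ∂μ ∂μ := by
  rw [diffMeasure, Measure.lintegral_conv hf]
  refine lintegral_congr fun x => ?_
  rw [lintegral_map (by fun_prop) (by fun_prop)]
  simp [sub_eq_add_neg]

theorem integrable_gaussian_mul_norm_charFun_sq (μ : Measure V) [IsFiniteMeasure μ] {c : ℝ}
    (hc : 0 < c) :
    Integrable fun ξ : V => Real.exp (-c * ‖ξ‖ ^ 2) * ‖charFun μ ξ‖ ^ 2 := by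
  refine (integrable_exp_neg_norm_sq (V := V) hc).mul_bdd (c := μ.real Set.univ ^ 2) ?_ ?_
  · exact ((measurable_charFun (μ := μ)).norm.pow_const 2).aestronglyMeasurable
  · refine Filter.Eventually.of_forall fun ξ => ?_
    rw [Real.norm_of_nonneg (by positivity)]
    exact pow_le_pow_left₀ (norm_nonneg _) (norm_charFun_le ξ) 2

/-- The transform of the difference measure is `|μ̂|² ≥ 0`. Pointwise Gaussian majorants on the
Fourier side can thus be turned back into energies of `μ` in physical space. -/
theorem integral_gaussian_diffMeasure (μ : Measure V) [IsFiniteMeasure μ] {b : ℝ} (hb : 0 < b) :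
    (4 * Real.pi * b) ^ (Module.finrank ℝ V / 2 : ℝ) *
        ∫ w, Real.exp (-b * ‖w‖ ^ 2) ∂(diffMeasure μ) =
      ∫ ξ : V, Real.exp (-(4 * b)⁻¹ * ‖ξ‖ ^ 2) * ‖charFun μ ξ‖ ^ 2 := by
  have h := integral_gaussian_eq_integral_charFun (diffMeasure μ) hb
  simp only [charFun_diffMeasure] at h
  rw [← Complex.ofReal_inj, Complex.ofReal_mul, h, ← integral_complex_ofReal]
  push_cast
  rfl

/-- If the Fourier transform of `a`, damped by a Gaussian, is dominated by a sum of Gaussians, then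
the Gaussian integral against `(x - y) + u` is dominated by the Gaussian energies of `μ`. -/
theorem integral_gaussian_diffMeasure_conv_le {ι : Type*} (s : Finset ι) (μ a : Measure V)
    [IsFiniteMeasure μ] [IsFiniteMeasure a] {b : ℝ} (hb : 0 < b) {c β : ι → ℝ}
    (hβ : ∀ j ∈ s, 0 < β j)
    (h : ∀ ξ : V, Real.exp (-(4 * b)⁻¹ * ‖ξ‖ ^ 2) * ‖charFun a ξ‖ ≤
      ∑ j ∈ s, c j * Real.exp (-(4 * β j)⁻¹ * ‖ξ‖ ^ 2)) :
    b ^ (Module.finrank ℝ V / 2 : ℝ) *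
        ∫ w, Real.exp (-b * ‖w‖ ^ 2) ∂(Measure.conv (diffMeasure μ) a) ≤
      ∑ j ∈ s, c j * (β j ^ (Module.finrank ℝ V / 2 : ℝ) *
        ∫ w, Real.exp (-β j * ‖w‖ ^ 2) ∂(diffMeasure μ)) := by
  set q : ℝ := Module.finrank ℝ V / 2
  have hpi : (0 : ℝ) < (4 * Real.pi) ^ q := by positivity
  refine le_of_mul_le_mul_left ?_ hpi
  have hL := integral_gaussian_eq_integral_charFun (Measure.conv (diffMeasure μ) a) hb
  have hnn : 0 ≤ ∫ w, Real.exp (-b * ‖w‖ ^ 2) ∂(Measure.conv (diffMeasure μ) a) :=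
    integral_nonneg fun w => (Real.exp_pos _).le
  have hbound : ∀ ξ : V, ‖(Real.exp (-(4 * b)⁻¹ * ‖ξ‖ ^ 2) : ℂ) *
      charFun (Measure.conv (diffMeasure μ) a) ξ‖ ≤
      ∑ j ∈ s, c j * (Real.exp (-(4 * β j)⁻¹ * ‖ξ‖ ^ 2) * ‖charFun μ ξ‖ ^ 2) := by
    intro ξ
    rw [charFun_conv, charFun_diffMeasure, norm_mul, norm_mul, Complex.norm_real,
      Complex.norm_real, Real.norm_of_nonneg (Real.exp_pos _).le,
      Real.norm_of_nonneg (by positivity)]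
    calc _ = (Real.exp (-(4 * b)⁻¹ * ‖ξ‖ ^ 2) * ‖charFun a ξ‖) * ‖charFun μ ξ‖ ^ 2 := by ring
      _ ≤ (∑ j ∈ s, c j * Real.exp (-(4 * β j)⁻¹ * ‖ξ‖ ^ 2)) * ‖charFun μ ξ‖ ^ 2 := by
        gcongr; exact h ξ
      _ = _ := by rw [Finset.sum_mul]; simp only [mul_assoc]
  have hint : ∀ j ∈ s, Integrable fun ξ : V =>
      c j * (Real.exp (-(4 * β j)⁻¹ * ‖ξ‖ ^ 2) * ‖charFun μ ξ‖ ^ 2) := fun j hj =>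
    (integrable_gaussian_mul_norm_charFun_sq μ
      (by have := hβ j hj; positivity)).const_mul _
  calc (4 * Real.pi) ^ q * (b ^ q *
        ∫ w, Real.exp (-b * ‖w‖ ^ 2) ∂(Measure.conv (diffMeasure μ) a))
      = ‖(((4 * Real.pi * b) ^ q : ℝ) : ℂ) *
        ((∫ w, Real.exp (-b * ‖w‖ ^ 2) ∂(Measure.conv (diffMeasure μ) a) : ℝ) : ℂ)‖ := by
        rw [← Complex.ofReal_mul, Complex.norm_real, Real.norm_of_nonneg (by positivity),
          Real.mul_rpow (by positivity) hb.le, mul_assoc]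
    _ ≤ ∫ ξ : V, ∑ j ∈ s, c j * (Real.exp (-(4 * β j)⁻¹ * ‖ξ‖ ^ 2) * ‖charFun μ ξ‖ ^ 2) := by
        rw [hL]
        exact norm_integral_le_of_norm_le (integrable_finsetSum s hint)
          (Filter.Eventually.of_forall hbound)
    _ = _ := by
        rw [integral_finsetSum s hint, Finset.mul_sum]
        refine Finset.sum_congr rfl fun j hj => ?_
        rw [integral_const_mul, ← integral_gaussian_diffMeasure μ (hβ j hj),
          Real.mul_rpow (by positivity) (hβ j hj).le]
        ring

end Gaussian

/-! ### Volume and Gaussian averages of discrete `α`-sets. -/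

theorem summable_exp_neg_mul_add_two_rpow (α : ℝ) :
    Summable fun m : ℕ => Real.exp (-m) * ((m : ℝ) + 2) ^ α := by
  have h := (summable_nat_add_iff 2).2 (Real.summable_pow_mul_exp_neg_nat_mul ⌈α⌉₊ one_pos)
  refine Summable.of_nonneg_of_le (fun m => by positivity) (fun m => ?_) (h.mul_left (Real.exp 2))
  have h1 : ((m : ℝ) + 2) ^ α ≤ ((m : ℝ) + 2) ^ ⌈α⌉₊ := by
    rw [← Real.rpow_natCast]
    exact Real.rpow_le_rpow_of_exponent_le (by linarith [m.cast_nonneg (α := ℝ)]) (Nat.le_ceil α)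
  have h2 : Real.exp (-m) = Real.exp 2 * Real.exp (-1 * ((m + 2 : ℕ) : ℝ)) := by
    rw [← Real.exp_add]; congr 1; push_cast; ring
  rw [h2]
  push_cast
  calc _ ≤ Real.exp 2 * Real.exp (-1 * ((m : ℝ) + 2)) * ((m : ℝ) + 2) ^ ⌈α⌉₊ := by gcongr
    _ = _ := by ring

section DiscreteSet

variable {d : ℕ} {α : ℝ} {K : Set (EuclideanSpace ℝ (Fin d))}

theorem IsDiscreteAlphaSet.exists_nonneg (h : IsDiscreteAlphaSet α K) :
    ∃ C : ℝ, 0 ≤ C ∧ ∀ δ : ℝ, 0 < δ → δ ≤ 1 → ∀ (x : EuclideanSpace ℝ (Fin d)) (r : ℝ), δ ≤ r →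
      volume (Metric.thickening δ K ∩ Metric.ball x r) ≤
        ENNReal.ofReal (C * (r / δ) ^ α * δ ^ d) := by
  obtain ⟨C, hC⟩ := h
  refine ⟨max C 0, le_max_right _ _, fun δ h0 h1 x r hr => (hC δ h0 h1 x r hr).trans ?_⟩
  have : 0 ≤ r / δ := div_nonneg (h0.le.trans hr) h0.le
  gcongr
  exact le_max_left _ _

theorem IsDiscreteAlphaSet.exists_volume_thickening_le (h : IsDiscreteAlphaSet α K)
    (hK : Bornology.IsBounded K) :
    ∃ C : ℝ, 0 ≤ C ∧ ∀ δ : ℝ, 0 < δ → δ ≤ 1 →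
      volume (Metric.thickening δ K) ≤ ENNReal.ofReal (C * δ ^ ((d : ℝ) - α)) := by
  obtain ⟨C, hC0, hC⟩ := h.exists_nonneg
  obtain ⟨R, hR⟩ := hK.subset_ball 0
  -- The added `1` makes one ball contain every `K_δ` with `δ ≤ 1`, and makes its radius an
  -- admissible `r ≥ δ`.
  set R' := max R 0 + 1 with hR'
  have hR'1 : 1 ≤ R' := by simp [hR']
  refine ⟨C * R' ^ α, by positivity, fun δ h0 h1 => ?_⟩
  have hsub : Metric.thickening δ K ⊆ Metric.ball 0 R' := by
    intro x hx
    obtain ⟨z, hz, hxz⟩ := Metric.mem_thickening_iff.1 hx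
    have h2 := hR hz
    rw [Metric.mem_ball] at h2 ⊢
    calc dist x 0 ≤ dist x z + dist z 0 := dist_triangle _ _ _
      _ < δ + R := add_lt_add hxz h2
      _ ≤ R' := by linarith [le_max_left R 0]
  have h3 := hC δ h0 h1 0 R' (h1.trans hR'1)
  rw [Set.inter_eq_left.2 hsub] at h3
  refine h3.trans (le_of_eq ?_)
  congr 1
  rw [Real.div_rpow (by linarith) h0.le, Real.rpow_sub h0, Real.rpow_natCast]
  ring

/-- The Gaussian is majorised by `∑ exp (-m)` times indicators of balls of radius `(m+2) r`. The
regularity condition costs only `(m+2)^α` on each ball. Radii start at `2r`, so that `δ ≤ 2r` is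
enough to apply it. -/
theorem IsDiscreteAlphaSet.exists_lintegral_gaussian_le (h : IsDiscreteAlphaSet α K) :
    ∃ C : ℝ, 0 ≤ C ∧ ∀ δ : ℝ, 0 < δ → δ ≤ 1 → ∀ r : ℝ, δ ≤ 2 * r →
      ∀ x : EuclideanSpace ℝ (Fin d),
      ∫⁻ y in Metric.thickening δ K, ENNReal.ofReal (Real.exp (-(r ^ 2)⁻¹ * ‖x - y‖ ^ 2)) ≤
        ENNReal.ofReal (C * (r / δ) ^ α * δ ^ d) := by
  obtain ⟨C, hC0, hC⟩ := h.exists_nonneg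
  have hsum := summable_exp_neg_mul_add_two_rpow α
  refine ⟨C * ∑' m : ℕ, Real.exp (-m) * ((m : ℝ) + 2) ^ α, by positivity,
    fun δ h0 h1 r hr x => ?_⟩
  have hr0 : 0 < r := by linarith
  have hpt : ∀ y : EuclideanSpace ℝ (Fin d),
      ENNReal.ofReal (Real.exp (-(r ^ 2)⁻¹ * ‖x - y‖ ^ 2)) ≤
        ∑' m : ℕ, (Metric.ball x ((m + 2) * r)).indicator
          (fun _ => ENNReal.ofReal (Real.exp (-m))) y := by
    intro y
    set t := ‖x - y‖ / r with ht
    have ht0 : 0 ≤ t := by positivity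
    refine le_trans ?_ (ENNReal.le_tsum ⌊t⌋₊)
    have hlt : t < ⌊t⌋₊ + 2 := by linarith [Nat.lt_floor_add_one t]
    have hmem : y ∈ Metric.ball x ((⌊t⌋₊ + 2) * r) := by
      rw [Metric.mem_ball, dist_comm, dist_eq_norm]
      rwa [ht, div_lt_iff₀ hr0] at hlt
    rw [Set.indicator_of_mem hmem]
    refine ENNReal.ofReal_le_ofReal (Real.exp_le_exp.2 ?_)
    have h2 : -(r ^ 2)⁻¹ * ‖x - y‖ ^ 2 = -t ^ 2 := by rw [ht]; field_simp
    rw [h2]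
    have h3 : (⌊t⌋₊ : ℝ) ≤ t := Nat.floor_le ht0
    have h4 : (⌊t⌋₊ : ℝ) ≤ (⌊t⌋₊ : ℝ) ^ 2 := by
      exact_mod_cast Nat.le_self_pow two_ne_zero _
    have h5 : (⌊t⌋₊ : ℝ) ^ 2 ≤ t ^ 2 := pow_le_pow_left₀ (Nat.cast_nonneg _) h3 2
    linarith
  calc _ ≤ ∫⁻ y in Metric.thickening δ K, ∑' m : ℕ, (Metric.ball x ((m + 2) * r)).indicator
          (fun _ => ENNReal.ofReal (Real.exp (-m))) y := lintegral_mono fun y => hpt y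
    _ = ∑' m : ℕ, ENNReal.ofReal (Real.exp (-m)) *
          volume (Metric.thickening δ K ∩ Metric.ball x ((m + 2) * r)) := by
        rw [lintegral_tsum fun m => (measurable_const.indicator measurableSet_ball).aemeasurable]
        refine tsum_congr fun m => ?_
        rw [lintegral_indicator measurableSet_ball, setLIntegral_const,
          Measure.restrict_apply measurableSet_ball, Set.inter_comm]
    _ ≤ ∑' m : ℕ, ENNReal.ofReal ((C * (r / δ) ^ α * δ ^ d) *
          (Real.exp (-m) * ((m : ℝ) + 2) ^ α)) := by
        refine ENNReal.tsum_le_tsum fun m => ?_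
        have hle : δ ≤ (m + 2) * r := hr.trans (by nlinarith [m.cast_nonneg (α := ℝ)])
        refine (mul_le_mul_right (hC δ h0 h1 x _ hle) _).trans (le_of_eq ?_)
        rw [← ENNReal.ofReal_mul (Real.exp_pos _).le, mul_div_assoc,
          Real.mul_rpow (by positivity) (by positivity)]
        congr 1; ring
    _ = _ := by
        rw [← ENNReal.ofReal_tsum_of_nonneg (fun m => by positivity) (hsum.mul_left _),
          tsum_mul_left]
        congr 1; ring

end DiscreteSet

/-! ### Volume of the neighbourhood of the set of unit pairs. -/

/-- For every `ξ` a single term dominates: `j = 0` if `‖ξ‖ ≤ 1`, the least `j` with `‖ξ‖ ≤ 2^j` for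
intermediate frequencies, and `j = J` beyond `2^J`. The condition `δ ≤ 1/8` ensures `3δ < 1`. -/
theorem exists_damped_charFun_annulus_le (n : ℕ) :
    ∃ C, 0 ≤ C ∧ ∀ δ : ℝ, 0 < δ → δ ≤ 1 / 8 → ∀ J : ℕ, δ⁻¹ ≤ 2 ^ J →
      ∀ ξ : EuclideanSpace ℝ (Fin (n + 1)),
      Real.exp (-(4 * (δ ^ 2)⁻¹)⁻¹ * ‖ξ‖ ^ 2) *
          ‖charFun (volume.restrict (annulus (n + 1) (3 * δ))) ξ‖ ≤
        ∑ j ∈ Finset.range (J + 1), (C * δ * ((2 : ℝ) ^ j) ^ (-(n / 2 : ℝ))) *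
          Real.exp (-(4 * ((2 : ℝ) ^ j) ^ 2)⁻¹ * ‖ξ‖ ^ 2) := by
  obtain ⟨C₁, hC₁, h1⟩ := exists_norm_charFun_annulus_le n
  obtain ⟨C₂, hC₂, h2⟩ := exists_norm_charFun_annulus_le_rpow n
  -- The `3` comes from the half-width `3δ`, `2^(n/2)` from replacing `‖ξ‖ ≥ 2^j / 2` by `2^j`, and
  -- `exp (1/4)` compensates the Gaussian on `‖ξ‖ ≤ 2^j`.
  set C := 3 * (C₁ + C₂ * 2 ^ (n / 2 : ℝ)) * Real.exp (1 / 4) with hC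
  have hC0 : 0 ≤ C := by positivity
  refine ⟨C, hC0, fun δ hδ hδ8 J hJ ξ => ?_⟩
  set A := ‖charFun (volume.restrict (annulus (n + 1) (3 * δ))) ξ‖ with hA
  suffices hsuff : ∃ j ≤ J, Real.exp (-(4 * (δ ^ 2)⁻¹)⁻¹ * ‖ξ‖ ^ 2) * A ≤
      (C * δ * ((2 : ℝ) ^ j) ^ (-(n / 2 : ℝ))) *
          Real.exp (-(4 * ((2 : ℝ) ^ j) ^ 2)⁻¹ * ‖ξ‖ ^ 2) by
    obtain ⟨j, hj, hle⟩ := hsuff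
    refine hle.trans (Finset.single_le_sum (f := fun j : ℕ =>
      (C * δ * ((2 : ℝ) ^ j) ^ (-(n / 2 : ℝ))) *
          Real.exp (-(4 * ((2 : ℝ) ^ j) ^ 2)⁻¹ * ‖ξ‖ ^ 2)) (fun i _ => by positivity)
      (Finset.mem_range.2 (Nat.lt_succ_of_le hj)))
  have hdamp : Real.exp (-(4 * (δ ^ 2)⁻¹)⁻¹ * ‖ξ‖ ^ 2) ≤ 1 :=
    Real.exp_le_one_iff.2 (by
      have : 0 ≤ (4 * (δ ^ 2)⁻¹)⁻¹ * ‖ξ‖ ^ 2 := by positivity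
      linarith)
  have hnear : ∀ j : ℕ, ‖ξ‖ ≤ 2 ^ j →
      1 ≤ Real.exp (1 / 4) * Real.exp (-(4 * ((2 : ℝ) ^ j) ^ 2)⁻¹ * ‖ξ‖ ^ 2) := by
    intro j hj
    rw [← Real.exp_add]
    refine Real.one_le_exp ?_
    have : ‖ξ‖ ^ 2 ≤ (2 ^ j) ^ 2 := pow_le_pow_left₀ (norm_nonneg _) hj 2
    have h4 : (4 * ((2 : ℝ) ^ j) ^ 2)⁻¹ * ‖ξ‖ ^ 2 ≤ 1 / 4 := by
      rw [inv_mul_le_iff₀ (by positivity)]; linarith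
    linarith
  rcases le_or_gt ‖ξ‖ 1 with hξ | hξ
  · refine ⟨0, Nat.zero_le _, ?_⟩
    have hA1 : A ≤ C₁ * (3 * δ) := h1 _ (by linarith) (by linarith) ξ
    have h5 := hnear 0 (by simpa using hξ)
    have h6 : 0 ≤ C₂ * 2 ^ (n / 2 : ℝ) := by positivity
    simp only [pow_zero, Real.one_rpow, mul_one] at h5 ⊢
    calc _ ≤ 1 * (C₁ * (3 * δ)) := by gcongr
      _ ≤ (C₁ * (3 * δ)) * (Real.exp (1 / 4) * Real.exp (-(4 * (1 : ℝ) ^ 2)⁻¹ * ‖ξ‖ ^ 2)) := by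
        rw [one_mul]; exact le_mul_of_one_le_right (by positivity) h5
      _ ≤ ((C₁ + C₂ * 2 ^ (n / 2 : ℝ)) * (3 * δ)) *
          (Real.exp (1 / 4) * Real.exp (-(4 * (1 : ℝ) ^ 2)⁻¹ * ‖ξ‖ ^ 2)) := by
        gcongr; linarith
      _ = _ := by rw [hC]; ring
  have hξ0 : ξ ≠ 0 := norm_pos_iff.1 (one_pos.trans hξ)
  have hA2 : A ≤ C₂ * (3 * δ) * ‖ξ‖ ^ (-(n / 2 : ℝ)) := h2 _ (by linarith) (by linarith) ξ hξ0
  rcases le_or_gt ‖ξ‖ (2 ^ J) with hJξ | hJξ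
  · have hex : ∃ j : ℕ, ‖ξ‖ ≤ 2 ^ j := ⟨J, hJξ⟩
    classical
    obtain ⟨j, hj, hmin⟩ : ∃ j : ℕ, ‖ξ‖ ≤ 2 ^ j ∧ ∀ i < j, ¬ ‖ξ‖ ≤ 2 ^ i :=
      ⟨Nat.find hex, Nat.find_spec hex, fun i hi => Nat.find_min hex hi⟩
    have hjJ : j ≤ J := not_lt.1 fun hlt => hmin J hlt hJξ
    have hj0 : j ≠ 0 := fun h => by rw [h, pow_zero] at hj; linarith
    have hlow : (2 : ℝ) ^ j / 2 ≤ ‖ξ‖ := by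
      obtain ⟨i, rfl⟩ := Nat.exists_eq_succ_of_ne_zero hj0
      have := hmin i (Nat.lt_succ_self i)
      rw [Nat.succ_eq_add_one, pow_succ]
      linarith
    refine ⟨j, hjJ, ?_⟩
    have hpw : ‖ξ‖ ^ (-(n / 2 : ℝ)) ≤ 2 ^ (n / 2 : ℝ) * ((2 : ℝ) ^ j) ^ (-(n / 2 : ℝ)) := by
      refine (Real.rpow_le_rpow_of_nonpos (by positivity) hlow
        (by rw [neg_nonpos]; positivity)).trans (le_of_eq ?_)
      rw [Real.div_rpow (by positivity) (by norm_num), Real.rpow_neg (by norm_num : (0 : ℝ) ≤ 2)]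
      field_simp
    have h5 := hnear j hj
    calc _ ≤ 1 * (C₂ * (3 * δ) * (2 ^ (n / 2 : ℝ) * ((2 : ℝ) ^ j) ^ (-(n / 2 : ℝ)))) := by
          gcongr; exact hA2.trans (by gcongr)
      _ ≤ (C₂ * (3 * δ) * (2 ^ (n / 2 : ℝ) * ((2 : ℝ) ^ j) ^ (-(n / 2 : ℝ)))) *
          (Real.exp (1 / 4) * Real.exp (-(4 * ((2 : ℝ) ^ j) ^ 2)⁻¹ * ‖ξ‖ ^ 2)) := by
        rw [one_mul]; exact le_mul_of_one_le_right (by positivity) h5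
      _ = (C₂ * 2 ^ (n / 2 : ℝ)) * ((3 * δ) * ((2 : ℝ) ^ j) ^ (-(n / 2 : ℝ)) *
          (Real.exp (1 / 4) * Real.exp (-(4 * ((2 : ℝ) ^ j) ^ 2)⁻¹ * ‖ξ‖ ^ 2))) := by ring
      _ ≤ (C₁ + C₂ * 2 ^ (n / 2 : ℝ)) * ((3 * δ) * ((2 : ℝ) ^ j) ^ (-(n / 2 : ℝ)) *
          (Real.exp (1 / 4) * Real.exp (-(4 * ((2 : ℝ) ^ j) ^ 2)⁻¹ * ‖ξ‖ ^ 2))) := by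
        gcongr; linarith
      _ = _ := by rw [hC]; ring
  -- Above `2^J ≥ 1/δ` the damping `exp (-δ²‖ξ‖²/4)` is itself at most the Gaussian of index `J`.
  · refine ⟨J, le_rfl, ?_⟩
    have hpw : ‖ξ‖ ^ (-(n / 2 : ℝ)) ≤ ((2 : ℝ) ^ J) ^ (-(n / 2 : ℝ)) :=
      Real.rpow_le_rpow_of_nonpos (by positivity) hJξ.le (by rw [neg_nonpos]; positivity)
    have hdamp' : Real.exp (-(4 * (δ ^ 2)⁻¹)⁻¹ * ‖ξ‖ ^ 2) ≤
        Real.exp (-(4 * ((2 : ℝ) ^ J) ^ 2)⁻¹ * ‖ξ‖ ^ 2) := by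
      rw [Real.exp_le_exp, neg_mul, neg_mul, neg_le_neg_iff]
      gcongr
      rw [← inv_pow]
      gcongr
    have hCC : C₂ * 3 ≤ C := by
      have ha : 1 ≤ (2 : ℝ) ^ (n / 2 : ℝ) := Real.one_le_rpow one_le_two (by positivity)
      have hb : 1 ≤ Real.exp (1 / 4) := Real.one_le_exp (by norm_num)
      have hc : C₂ ≤ C₂ * 2 ^ (n / 2 : ℝ) := le_mul_of_one_le_right hC₂ ha
      calc C₂ * 3 ≤ 3 * (C₁ + C₂ * 2 ^ (n / 2 : ℝ)) := by linarith
        _ ≤ C := le_mul_of_one_le_right (by positivity) hb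
    calc _ ≤ Real.exp (-(4 * ((2 : ℝ) ^ J) ^ 2)⁻¹ * ‖ξ‖ ^ 2) *
          (C₂ * (3 * δ) * ((2 : ℝ) ^ J) ^ (-(n / 2 : ℝ))) := by
          gcongr; exact hA2.trans (by gcongr)
      _ = C₂ * 3 * (δ * ((2 : ℝ) ^ J) ^ (-(n / 2 : ℝ)) *
          Real.exp (-(4 * ((2 : ℝ) ^ J) ^ 2)⁻¹ * ‖ξ‖ ^ 2)) := by ring
      _ ≤ C * (δ * ((2 : ℝ) ^ J) ^ (-(n / 2 : ℝ)) *
          Real.exp (-(4 * ((2 : ℝ) ^ J) ^ 2)⁻¹ * ‖ξ‖ ^ 2)) := by gcongr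
      _ = _ := by ring

/-- Differences close to the unit sphere have small `diffMeasure`, up to a Gaussian average over
an annulus. -/
theorem mul_diffMeasure_le_integral_gaussian (n : ℕ)
    (μ : Measure (EuclideanSpace ℝ (Fin (n + 1)))) [IsFiniteMeasure μ] {δ : ℝ} (hδ : 0 < δ) :
    ENNReal.ofReal (Real.exp (-1) * (δ ^ (n + 1) *
        volume.real (Metric.ball (0 : EuclideanSpace ℝ (Fin (n + 1))) 1))) *
        diffMeasure μ {w | |‖w‖ - 1| < 2 * δ} ≤
      ENNReal.ofReal (∫ w, Real.exp (-(δ ^ 2)⁻¹ * ‖w‖ ^ 2)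
        ∂(Measure.conv (diffMeasure μ) (volume.restrict (annulus (n + 1) (3 * δ))))) := by
  have : IsFiniteMeasure (volume.restrict (annulus (n + 1) (3 * δ))) :=
    isFiniteMeasure_restrict.2 (volume_annulus_lt_top _ _).ne
  set a := volume.restrict (annulus (n + 1) (3 * δ)) with ha
  set S : Set (EuclideanSpace ℝ (Fin (n + 1))) := {w | |‖w‖ - 1| < 2 * δ} with hS
  have hSm : MeasurableSet S := measurableSet_lt (by fun_prop) measurable_const
  have hint : Integrable (fun w : EuclideanSpace ℝ (Fin (n + 1)) =>
      Real.exp (-(δ ^ 2)⁻¹ * ‖w‖ ^ 2)) (Measure.conv (diffMeasure μ) a) := by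
    refine (integrable_const (1 : ℝ)).mono (by fun_prop) (Filter.Eventually.of_forall fun w => ?_)
    rw [Real.norm_of_nonneg (Real.exp_pos _).le, norm_one, Real.exp_le_one_iff]
    have : 0 ≤ (δ ^ 2)⁻¹ * ‖w‖ ^ 2 := by positivity
    linarith
  rw [ofReal_integral_eq_lintegral_ofReal hint
    (Filter.Eventually.of_forall fun w => (Real.exp_pos _).le),
    Measure.lintegral_conv (by fun_prop), ← setLIntegral_const, ← lintegral_indicator hSm]
  refine lintegral_mono fun w => ?_
  by_cases hw : w ∈ S
  swap
  · rw [Set.indicator_of_notMem hw]; exact zero_le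
  rw [Set.indicator_of_mem hw]
  have hw' := abs_lt.1 (show |‖w‖ - 1| < 2 * δ from hw)
  -- If `‖w‖` is within `2δ` of `1`, moving by `δ` stays within `3δ`; hence the half-width of the
  -- annulus. For `u` in this ball the Gaussian at `w + u` is at least `exp (-1)`.
  have hsub : Metric.ball (-w) δ ⊆ annulus (n + 1) (3 * δ) := by
    intro u hu
    rw [mem_ball_iff_norm, sub_neg_eq_add] at hu
    have h1 : ‖u‖ ≤ ‖u + w‖ + ‖w‖ := by
      simpa using norm_sub_le (u + w) w
    have h2 : ‖w‖ ≤ ‖u + w‖ + ‖u‖ := by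
      simpa using norm_sub_le (u + w) u
    refine ⟨?_, ?_⟩ <;> rw [mem_ball_zero_iff] <;> linarith
  calc ENNReal.ofReal (Real.exp (-1) * (δ ^ (n + 1) *
        volume.real (Metric.ball (0 : EuclideanSpace ℝ (Fin (n + 1))) 1)))
      = ENNReal.ofReal (Real.exp (-1)) * a (Metric.ball (-w) δ) := by
        rw [ENNReal.ofReal_mul (Real.exp_pos _).le, ha, Measure.restrict_apply measurableSet_ball,
          Set.inter_eq_left.2 hsub, Measure.addHaar_ball_of_pos _ _ hδ,
          finrank_euclideanSpace_fin, ENNReal.ofReal_mul (by positivity),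
          ofReal_measureReal measure_ball_lt_top.ne]
    _ = ∫⁻ _ in Metric.ball (-w) δ, ENNReal.ofReal (Real.exp (-1)) ∂a := by
        rw [setLIntegral_const]
    _ ≤ ∫⁻ u in Metric.ball (-w) δ, ENNReal.ofReal (Real.exp (-(δ ^ 2)⁻¹ * ‖w + u‖ ^ 2)) ∂a := by
        refine setLIntegral_mono' measurableSet_ball fun u hu => ?_
        rw [mem_ball_iff_norm, sub_neg_eq_add, add_comm u w] at hu
        refine ENNReal.ofReal_le_ofReal (Real.exp_le_exp.2 ?_)
        have : (δ ^ 2)⁻¹ * ‖w + u‖ ^ 2 ≤ 1 := by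
          rw [inv_mul_le_iff₀ (by positivity), mul_one]
          exact pow_le_pow_left₀ (norm_nonneg _) hu.le 2
        linarith
    _ ≤ _ := setLIntegral_le_lintegral _ _

/-- Moving both points of a pair by less than `δ` changes their distance by less than `2δ`. -/
theorem volume_thickening_unitPairs_le {d : ℕ} (K : Set (EuclideanSpace ℝ (Fin d))) {δ : ℝ}
    (hfin : volume (Metric.thickening δ K) < ⊤) :
    volume (Metric.thickening δ (unitPairs K)) ≤
      diffMeasure (volume.restrict (Metric.thickening δ K)) {w | |‖w‖ - 1| < 2 * δ} := by
  have : IsFiniteMeasure (volume.restrict (Metric.thickening δ K)) :=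
    isFiniteMeasure_restrict.2 hfin.ne
  set L := Metric.thickening δ K with hL
  set S : Set (EuclideanSpace ℝ (Fin d)) := {w | |‖w‖ - 1| < 2 * δ} with hS
  have hSm : MeasurableSet S := measurableSet_lt (by fun_prop) measurable_const
  have hLm : MeasurableSet L := Metric.isOpen_thickening.measurableSet
  have hTm : MeasurableSet {p : EuclideanSpace ℝ (Fin d) × EuclideanSpace ℝ (Fin d) |
      p.1 - p.2 ∈ S} := (by fun_prop : Measurable fun p : EuclideanSpace ℝ (Fin d) ×
        EuclideanSpace ℝ (Fin d) => p.1 - p.2) hSm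
  have hsub : Metric.thickening δ (unitPairs K) ⊆ {p | p.1 - p.2 ∈ S} ∩ L ×ˢ L := by
    rintro ⟨x, y⟩ hp
    obtain ⟨⟨k₁, k₂⟩, ⟨h1, h2, h3⟩, hd⟩ := Metric.mem_thickening_iff.1 hp
    rw [Prod.dist_eq, max_lt_iff] at hd
    obtain ⟨hx, hy⟩ := hd
    simp only at h1 h2 h3 hx hy
    refine ⟨?_, Metric.mem_thickening_iff.2 ⟨k₁, h1, hx⟩, Metric.mem_thickening_iff.2 ⟨k₂, h2, hy⟩⟩
    change |‖x - y‖ - 1| < 2 * δ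
    rw [← h3, norm_sub_rev k₂ k₁]
    calc |‖x - y‖ - ‖k₁ - k₂‖| ≤ ‖(x - y) - (k₁ - k₂)‖ := abs_norm_sub_norm_le _ _
      _ = ‖(x - k₁) - (y - k₂)‖ := by congr 1; abel
      _ ≤ ‖x - k₁‖ + ‖y - k₂‖ := norm_sub_le _ _
      _ < 2 * δ := by rw [dist_eq_norm] at hx hy; linarith
  calc _ ≤ volume ({p | p.1 - p.2 ∈ S} ∩ L ×ˢ L) := measure_mono hsub
    _ = ((volume.restrict L).prod (volume.restrict L)) {p | p.1 - p.2 ∈ S} := by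
        rw [Measure.prod_restrict, Measure.restrict_apply hTm, Measure.volume_eq_prod]
    _ = diffMeasure (volume.restrict L) S := by
        rw [← lintegral_indicator_one hSm, lintegral_diffMeasure _ (measurable_one.indicator hSm),
          Measure.prod_apply hTm]
        refine lintegral_congr fun x => ?_
        have hm : MeasurableSet {y | x - y ∈ S} :=
          (by fun_prop : Measurable fun y : EuclideanSpace ℝ (Fin d) => x - y) hSm
        rw [show (Prod.mk x ⁻¹' {p : EuclideanSpace ℝ (Fin d) × EuclideanSpace ℝ (Fin d) |
          p.1 - p.2 ∈ S}) = {y | x - y ∈ S} from rfl, ← lintegral_indicator_one hm]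
        rfl

theorem integral_gaussian_diffMeasure_le {d : ℕ} {b M B : ℝ} (hM : 0 ≤ M)
    {L : Set (EuclideanSpace ℝ (Fin d))} (hB : 0 ≤ B)
    (hL : volume L ≤ ENNReal.ofReal M)
    (h : ∀ x, ∫⁻ y in L, ENNReal.ofReal (Real.exp (-b * ‖x - y‖ ^ 2)) ≤ ENNReal.ofReal B) :
    ∫ w, Real.exp (-b * ‖w‖ ^ 2) ∂(diffMeasure (volume.restrict L)) ≤ B * M := by
  have : IsFiniteMeasure (volume.restrict L) :=
    isFiniteMeasure_restrict.2 (hL.trans_lt ENNReal.ofReal_lt_top).ne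
  rw [integral_eq_lintegral_of_nonneg_ae
    (Filter.Eventually.of_forall fun w => (Real.exp_pos _).le) (by fun_prop)]
  refine ENNReal.toReal_le_of_le_ofReal (by positivity) ?_
  rw [lintegral_diffMeasure _ (by fun_prop)]
  calc _ ≤ ∫⁻ _ in L, ENNReal.ofReal B := lintegral_mono fun x => h x
    _ = ENNReal.ofReal B * volume L := by rw [setLIntegral_const]
    _ ≤ ENNReal.ofReal B * ENNReal.ofReal M := by gcongr
    _ = _ := (ENNReal.ofReal_mul hB).symm

/-- Replacing `e` by a positive `η ≥ e` gives a geometric sum governed by its last term. This avoids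
a logarithm at `e = 0`, at no cost since only exponents strictly above the critical one are needed.
-/
theorem exists_sum_two_pow_rpow_le {e η : ℝ} (hη : 0 < η) (he : e ≤ η) :
    ∃ C : ℝ, 0 ≤ C ∧ ∀ δ : ℝ, 0 < δ → ∀ J : ℕ, (2 : ℝ) ^ J ≤ 2 * δ⁻¹ →
      ∑ j ∈ Finset.range (J + 1), ((2 : ℝ) ^ j) ^ e ≤ C * δ ^ (-η) := by
  set q : ℝ := 2 ^ η with hq
  have hq1 : 1 < q := Real.one_lt_rpow one_lt_two hη
  refine ⟨4 ^ η / (q - 1), div_nonneg (by positivity) (by linarith), fun δ hδ J hJ => ?_⟩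
  have hterm : ∀ j : ℕ, ((2 : ℝ) ^ j) ^ e ≤ q ^ j := by
    intro j
    calc ((2 : ℝ) ^ j) ^ e ≤ ((2 : ℝ) ^ j) ^ η :=
          Real.rpow_le_rpow_of_exponent_le (one_le_pow₀ one_le_two) he
      _ = q ^ j := by
        rw [hq, ← Real.rpow_natCast, ← Real.rpow_natCast, ← Real.rpow_mul (by norm_num),
          ← Real.rpow_mul (by norm_num), mul_comm]
  have hlast : q ^ (J + 1) ≤ 4 ^ η * δ ^ (-η) := by
    calc q ^ (J + 1) = ((2 : ℝ) ^ (J + 1)) ^ η := by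
          rw [hq, ← Real.rpow_natCast, ← Real.rpow_natCast, ← Real.rpow_mul (by norm_num),
            ← Real.rpow_mul (by norm_num), mul_comm]
      _ ≤ (4 * δ⁻¹) ^ η := by
          refine Real.rpow_le_rpow (by positivity) ?_ hη.le
          rw [pow_succ]; linarith
      _ = 4 ^ η * δ ^ (-η) := by
          rw [Real.mul_rpow (by norm_num) (by positivity), Real.inv_rpow hδ.le,
            Real.rpow_neg hδ.le]
  calc _ ≤ ∑ j ∈ Finset.range (J + 1), q ^ j := Finset.sum_le_sum fun j _ => hterm j
    _ = (q ^ (J + 1) - 1) / (q - 1) := geom_sum_eq hq1.ne' _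
    _ ≤ (4 ^ η * δ ^ (-η)) / (q - 1) := by
        have : 0 < q - 1 := by linarith
        gcongr
        linarith
    _ = _ := by ring

/-- The volume of the `δ`-neighbourhood of the set of unit pairs of a `δ`-discrete `α`-set. -/
theorem IsDiscreteAlphaSet.exists_volume_thickening_unitPairs_le {n : ℕ} {α s : ℝ}
    {K : Set (EuclideanSpace ℝ (Fin (n + 1)))} (h : IsDiscreteAlphaSet α K)
    (hK : Bornology.IsBounded K) (hs₁ : 2 * α - 1 < s) (hs₂ : α + n / 2 < s) :
    ∃ C : ℝ, 0 ≤ C ∧ ∀ δ : ℝ, 0 < δ → δ ≤ 1 / 8 →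
      volume (Metric.thickening δ (unitPairs K)) ≤
        ENNReal.ofReal (C * δ ^ (2 * ((n : ℝ) + 1) - s)) := by
  obtain ⟨C₁, hC₁, h1⟩ := h.exists_volume_thickening_le hK
  obtain ⟨C₂, hC₂, h2⟩ := h.exists_lintegral_gaussian_le
  obtain ⟨C₃, hC₃, h3⟩ := exists_damped_charFun_annulus_le n
  -- The exponent of `2^j` combines `-n/2` from Bessel decay, `n + 1` from Gaussian normalisation
  -- and `-α` from regularity. The two lower bounds on `s` say exactly that `η > 0` and `e < η`.
  obtain ⟨C₄, hC₄, h4⟩ := exists_sum_two_pow_rpow_le (e := (n : ℝ) / 2 + 1 - α)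
    (η := s - (2 * α - 1)) (by linarith) (by linarith)
  set v := volume.real (Metric.ball (0 : EuclideanSpace ℝ (Fin (n + 1))) 1) with hv
  have hv0 : 0 < v := ENNReal.toReal_pos (Metric.measure_ball_pos _ _ one_pos).ne'
    measure_ball_lt_top.ne
  refine ⟨C₃ * C₂ * C₁ * C₄ / (Real.exp (-1) * v), by positivity, fun δ hδ hδ8 => ?_⟩
  have hδ1 : δ ≤ 1 := by linarith
  obtain ⟨i, hi1, hi2⟩ := exists_nat_pow_near ((one_le_inv₀ hδ).2 hδ1) (one_lt_two (α := ℝ))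
  set J := i + 1 with hJ
  have hJ1 : δ⁻¹ ≤ 2 ^ J := hi2.le
  have hJ2 : (2 : ℝ) ^ J ≤ 2 * δ⁻¹ := by rw [hJ, pow_succ]; linarith
  set L := Metric.thickening δ K with hL
  have hLv := h1 δ hδ hδ1
  have hLfin : volume L < ⊤ := hLv.trans_lt ENNReal.ofReal_lt_top
  have : IsFiniteMeasure (volume.restrict L) := isFiniteMeasure_restrict.2 hLfin.ne
  have : IsFiniteMeasure (volume.restrict (annulus (n + 1) (3 * δ))) :=
    isFiniteMeasure_restrict.2 (volume_annulus_lt_top _ _).ne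
  have hE := integral_gaussian_diffMeasure_conv_le (Finset.range (J + 1)) (volume.restrict L)
    (volume.restrict (annulus (n + 1) (3 * δ))) (b := (δ ^ 2)⁻¹) (by positivity)
    (c := fun j => C₃ * δ * ((2 : ℝ) ^ j) ^ (-(n / 2 : ℝ))) (β := fun j => ((2 : ℝ) ^ j) ^ 2)
    (fun j _ => by positivity) (h3 δ hδ hδ8 J hJ1)
  rw [finrank_euclideanSpace_fin] at hE
  have hpow : ∀ x : ℝ, 0 < x → (x ^ 2) ^ (((n + 1 : ℕ) : ℝ) / 2) = x ^ (n + 1) := by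
    intro x hx
    rw [← Real.rpow_natCast x 2, ← Real.rpow_mul hx.le, ← Real.rpow_natCast x (n + 1)]
    congr 1; push_cast; ring
  set I := ∫ w, Real.exp (-(δ ^ 2)⁻¹ * ‖w‖ ^ 2)
    ∂(Measure.conv (diffMeasure (volume.restrict L)) (volume.restrict (annulus (n + 1) (3 * δ))))
    with hI
  have hterm : ∀ j ∈ Finset.range (J + 1),
      C₃ * δ * ((2 : ℝ) ^ j) ^ (-(n / 2 : ℝ)) * ((((2 : ℝ) ^ j) ^ 2) ^ (((n + 1 : ℕ) : ℝ) / 2) *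
        ∫ w, Real.exp (-((2 : ℝ) ^ j) ^ 2 * ‖w‖ ^ 2) ∂(diffMeasure (volume.restrict L))) ≤
      C₃ * C₂ * C₁ * (δ * (δ ^ ((n : ℝ) + 1 - α)) ^ 2) * ((2 : ℝ) ^ j) ^ ((n : ℝ) / 2 + 1 - α) := by
    intro j hj
    have hjJ : j ≤ J := Nat.lt_succ_iff.1 (Finset.mem_range.1 hj)
    have h2j : (0 : ℝ) < 2 ^ j := by positivity
    -- The finest scale `2^(-J)` can be as small as `δ/2`, hence the slack `δ ≤ 2r` in the Gaussian
    -- average.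
    have hr : δ ≤ 2 * ((2 : ℝ) ^ j)⁻¹ := by
      have : (2 : ℝ) ^ j ≤ 2 * δ⁻¹ := (pow_le_pow_right₀ one_le_two hjJ).trans hJ2
      rw [← div_eq_mul_inv, le_div_iff₀ h2j]
      calc δ * 2 ^ j ≤ δ * (2 * δ⁻¹) := by gcongr
        _ = 2 := by field_simp
    have hG := integral_gaussian_diffMeasure_le (b := ((2 : ℝ) ^ j) ^ 2)
      (B := C₂ * (((2 : ℝ) ^ j)⁻¹ / δ) ^ α * δ ^ (n + 1)) (by positivity) (by positivity) hLv
      (fun x => by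
        have := h2 δ hδ hδ1 ((2 : ℝ) ^ j)⁻¹ hr x
        rwa [inv_pow, inv_inv] at this)
    rw [hpow _ h2j]
    calc _ ≤ C₃ * δ * ((2 : ℝ) ^ j) ^ (-(n / 2 : ℝ)) * (((2 : ℝ) ^ j) ^ (n + 1) *
          ((C₂ * (((2 : ℝ) ^ j)⁻¹ / δ) ^ α * δ ^ (n + 1)) *
            (C₁ * δ ^ (((n + 1 : ℕ) : ℝ) - α)))) := by gcongr
      _ = _ := by
        have e1 : (((2 : ℝ) ^ j)⁻¹ / δ) ^ α * δ ^ (n + 1) =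
            ((2 : ℝ) ^ j) ^ (-α) * δ ^ ((n : ℝ) + 1 - α) := by
          rw [Real.div_rpow (by positivity) hδ.le, Real.inv_rpow h2j.le, Real.rpow_neg h2j.le,
            Real.rpow_sub hδ, show ((n : ℝ) + 1) = ((n + 1 : ℕ) : ℝ) by push_cast; ring,
            Real.rpow_natCast]
          ring
        have e2 : ((2 : ℝ) ^ j) ^ ((n : ℝ) / 2 + 1 - α) = ((2 : ℝ) ^ j) ^ (-(n / 2 : ℝ)) *
            ((2 : ℝ) ^ j) ^ (n + 1) * ((2 : ℝ) ^ j) ^ (-α) := by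
          rw [← Real.rpow_natCast _ (n + 1), ← Real.rpow_add h2j, ← Real.rpow_add h2j]
          congr 1; push_cast; ring
        rw [e2, mul_assoc C₂, e1]
        push_cast
        ring
  have hmain : I ≤ δ ^ (n + 1) * (C₃ * C₂ * C₁ * (δ * (δ ^ ((n : ℝ) + 1 - α)) ^ 2) *
      (C₄ * δ ^ (-(s - (2 * α - 1))))) := by
    have hE' := hE.trans ((Finset.sum_le_sum hterm).trans_eq (Finset.mul_sum _ _ _).symm)
    have hE'' := hE'.trans (mul_le_mul_of_nonneg_left (h4 δ hδ J hJ2) (by positivity))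
    rw [← inv_pow, hpow _ (inv_pos.2 hδ), inv_pow, inv_mul_le_iff₀ (by positivity)] at hE''
    exact hE''
  -- One `δ` is the annulus width. The two factors `δ^(n+1-α)` come from the Gaussian average and
  -- from `|K_δ|`, and the negative power from the dyadic sum.
  have hexp : δ * (δ ^ ((n : ℝ) + 1 - α)) ^ 2 * δ ^ (-(s - (2 * α - 1))) =
      δ ^ (2 * ((n : ℝ) + 1) - s) := by
    rw [← Real.rpow_natCast _ 2, ← Real.rpow_mul hδ.le]
    nth_rw 1 [← Real.rpow_one δ]
    rw [← Real.rpow_add hδ, ← Real.rpow_add hδ]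
    congr 1; push_cast; ring
  have hfin := mul_diffMeasure_le_integral_gaussian n (volume.restrict L) hδ
  refine (volume_thickening_unitPairs_le K hLfin).trans ?_
  have hX : 0 < Real.exp (-1) * (δ ^ (n + 1) * v) := by positivity
  rw [mul_comm, ← ENNReal.le_div_iff_mul_le
    (Or.inl (ENNReal.ofReal_pos.2 hX).ne') (Or.inl ENNReal.ofReal_ne_top),
    ← ENNReal.ofReal_div_of_pos hX] at hfin
  refine hfin.trans (ENNReal.ofReal_le_ofReal ?_)
  rw [div_le_iff₀ hX]
  refine hmain.trans (le_of_eq ?_)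
  rw [← hexp]
  field_simp

/-! ### From volume bounds to Minkowski and Hausdorff dimension. -/

theorem card_mul_le_volume_thickening {E : Type*} [NormedAddCommGroup E]
    [MeasureSpace E] [BorelSpace E] [(volume : Measure E).IsAddHaarMeasure] {A : Set E}
    {δ : ℝ} (hδ : 0 < δ) (F : Finset E) (hFA : (F : Set E) ⊆ A)
    (hF : Metric.IsSeparated (ENNReal.ofReal (2 * δ)) (F : Set E)) :
    (F.card : ℝ≥0∞) * volume (Metric.ball (0 : E) δ) ≤ volume (Metric.thickening δ A) := by
  have hdisj : (F : Set E).PairwiseDisjoint fun c => Metric.ball c δ := by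
    intro x hx y hy hxy
    refine Metric.ball_disjoint_ball ?_
    have : ENNReal.ofReal (2 * δ) < edist x y := hF hx hy hxy
    rw [edist_dist] at this
    linarith [((ENNReal.ofReal_lt_ofReal_iff_of_nonneg (by positivity)).1 this)]
  calc (F.card : ℝ≥0∞) * volume (Metric.ball (0 : E) δ)
      = ∑ c ∈ F, volume (Metric.ball c δ) := by
        simp [Measure.addHaar_ball_center]
    _ = volume (⋃ c ∈ F, Metric.ball c δ) :=
        (measure_biUnion_finset hdisj fun c _ => measurableSet_ball).symm
    _ ≤ _ := by
        refine measure_mono (Set.iUnion₂_subset fun c hc x hx => ?_)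
        exact Metric.mem_thickening_iff.2 ⟨c, hFA hc, hx⟩

section Dimension

variable {E : Type*} [NormedAddCommGroup E] [NormedSpace ℝ E] [MeasureSpace E]

/-- A power bound for the volume of neighbourhoods: `|A_δ| ≤ C δ^(n - s)` for small `δ`. -/
def HasVolumeBound (A : Set E) (s : ℝ) : Prop :=
  ∃ C : ℝ, 0 ≤ C ∧ ∃ δ₀ : ℝ, 0 < δ₀ ∧ ∀ δ : ℝ, 0 < δ → δ ≤ δ₀ →
    volume (Metric.thickening δ A) ≤ ENNReal.ofReal (C * δ ^ ((Module.finrank ℝ E : ℝ) - s))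

theorem upperMinkowskiDim_le_of_hasVolumeBound {A : Set E} {s₀ : ℝ}
    (h : ∀ s, s₀ < s → HasVolumeBound A s) : upperMinkowskiDim A ≤ (s₀ : EReal) := by
  refine EReal.le_of_forall_lt_iff_le.1 fun z hz => ?_
  have hz' : s₀ < z := by exact_mod_cast hz
  obtain ⟨s, hs1, hs2⟩ := exists_between hz'
  obtain ⟨C, hC, δ₀, hδ₀, hbd⟩ := h s hs1
  refine Filter.limsup_le_of_le (by isBoundedDefault) ?_
  -- The gap between `s` and `z` supplies a power of `δ` that swallows the constant `C`.
  have ht : Filter.Tendsto (fun δ : ℝ => C * δ ^ (z - s)) (𝓝[>] 0) (𝓝 0) := by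
    have h1 := (Real.continuousAt_rpow_const 0 (z - s) (Or.inr (by linarith))).tendsto
    rw [Real.zero_rpow (by linarith)] at h1
    simpa using (h1.mono_left nhdsWithin_le_nhds).const_mul C
  have hsmall : ∀ᶠ δ in 𝓝[>] (0 : ℝ), δ < min δ₀ 1 :=
    (eventually_lt_nhds (lt_min hδ₀ one_pos)).filter_mono nhdsWithin_le_nhds
  filter_upwards [ht.eventually (eventually_le_nhds one_pos), hsmall, self_mem_nhdsWithin]
    with δ h1 h2 h3
  have hδ : 0 < δ := h3
  have hδ1 : δ < 1 := h2.trans_le (min_le_right _ _)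
  set n : ℝ := (Module.finrank ℝ E : ℝ) with hn
  have hV : volume (Metric.thickening δ A) ≤ ENNReal.ofReal (δ ^ (n - z)) := by
    refine (hbd δ hδ (h2.le.trans (min_le_left _ _))).trans (ENNReal.ofReal_le_ofReal ?_)
    calc C * δ ^ (n - s) = (C * δ ^ (z - s)) * δ ^ (n - z) := by
          rw [mul_assoc, ← Real.rpow_add hδ]; congr 2; ring
      _ ≤ 1 * δ ^ (n - z) := by gcongr
      _ = _ := one_mul _
  have hlog : Real.log δ < 0 := Real.log_neg hδ hδ1
  have hL : ENNReal.log (volume (Metric.thickening δ A)) ≤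
      (((n - z) * Real.log δ : ℝ) : EReal) := by
    refine (ENNReal.log_le_log hV).trans (le_of_eq ?_)
    rw [ENNReal.log_ofReal_of_pos (by positivity), Real.log_rpow hδ]
  have hdiv : ((n - z : ℝ) : EReal) ≤
      ENNReal.log (volume (Metric.thickening δ A)) / (Real.log δ : EReal) := by
    refine le_trans (le_of_eq ?_) (EReal.div_le_div_right_of_nonpos
      (by exact_mod_cast hlog.le) hL)
    rw [← EReal.coe_div, mul_div_assoc, div_self hlog.ne, mul_one]
  refine (EReal.sub_le_sub le_rfl hdiv).trans (le_of_eq ?_)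
  rw [← EReal.coe_sub]
  congr 1
  ring

variable [FiniteDimensional ℝ E] [BorelSpace E] [(volume : Measure E).IsAddHaarMeasure]

/-- A maximal `2δ`-separated subset is a `2δ`-net, and the disjoint `δ`-balls around its points fit
into the neighbourhood. Finite volume forces the subset to be finite. -/
theorem exists_finset_cover {A : Set E} {δ : ℝ} (hδ : 0 < δ)
    (hfin : volume (Metric.thickening δ A) < ⊤) :
    ∃ F : Finset E, A ⊆ ⋃ c ∈ F, Metric.closedBall c (2 * δ) ∧
      (F.card : ℝ≥0∞) * volume (Metric.ball (0 : E) δ) ≤ volume (Metric.thickening δ A) := by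
  set ε : NNReal := ⟨2 * δ, by positivity⟩ with hε
  have hε' : (ε : ℝ≥0∞) = ENNReal.ofReal (2 * δ) := by
    rw [ENNReal.ofReal_eq_coe_nnreal (by positivity)]; rfl
  have hv0 : volume (Metric.ball (0 : E) δ) ≠ 0 := (Metric.measure_ball_pos _ _ hδ).ne'
  have hpack : Metric.packingNumber ε A ≠ ⊤ := by
    obtain ⟨N, hN⟩ := ENNReal.exists_nat_gt
      (ENNReal.div_lt_top hfin.ne hv0).ne
    refine ne_top_of_le_ne_top (ENat.natCast_ne_top N) (iSup_le fun C => iSup₂_le fun hCA hC => ?_)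
    by_contra hlt
    obtain ⟨t, htC, htN⟩ := Set.exists_subset_encard_eq (not_le.1 hlt).le
    have htf : t.Finite := Set.finite_of_encard_eq_coe htN
    have hcard : htf.toFinset.card = N := by
      rw [htf.encard_eq_coe_toFinset_card] at htN
      exact_mod_cast htN
    have := card_mul_le_volume_thickening hδ htf.toFinset (by simpa using htC.trans hCA)
      (by rw [htf.coe_toFinset, ← hε']; exact hC.mono htC)
    rw [hcard] at this
    have h2 := (ENNReal.le_div_iff_mul_le (Or.inl hv0) (Or.inl measure_ball_lt_top.ne)).2 this
    exact (h2.trans_lt hN).false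
  have hSf : (Metric.maximalSeparatedSet ε A).Finite := by
    rw [← Set.encard_ne_top_iff, Metric.encard_maximalSeparatedSet hpack]
    exact hpack
  refine ⟨hSf.toFinset, ?_, ?_⟩
  · have := (Metric.isCover_maximalSeparatedSet hpack).subset_iUnion_closedBall
    simp only [Set.Finite.mem_toFinset]
    exact this
  · refine card_mul_le_volume_thickening hδ _ (by simpa using Metric.maximalSeparatedSet_subset) ?_
    rw [hSf.coe_toFinset, ← hε']
    exact Metric.isSeparated_maximalSeparatedSet

/-- Covers by `O(δ^(-s))` balls of diameter at most `4δ`, along a sequence `δ → 0`, keep the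
`s`-dimensional Hausdorff measure finite. -/
theorem dimH_le_of_hasVolumeBound_self {A : Set E} {s : NNReal} (h : HasVolumeBound A s) :
    dimH A ≤ s := by
  obtain ⟨C, hC, δ₀, hδ₀, hbd⟩ := h
  set n := Module.finrank ℝ E with hn
  set δ : ℕ → ℝ := fun m => δ₀ / (m + 1) with hδdef
  have hδ : ∀ m, 0 < δ m := fun m => by positivity
  have hδle : ∀ m, δ m ≤ δ₀ := fun m =>
    div_le_self hδ₀.le (by linarith [m.cast_nonneg (α := ℝ)])
  have hδt : Filter.Tendsto δ Filter.atTop (𝓝 0) := by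
    simpa [hδdef, div_eq_mul_inv] using
      (tendsto_one_div_add_atTop_nhds_zero_nat (𝕜 := ℝ)).const_mul δ₀
  choose F hFA hFc using fun m => exists_finset_cover (A := A) (hδ m)
    ((hbd _ (hδ m) (hδle m)).trans_lt ENNReal.ofReal_lt_top)
  set v := volume.real (Metric.ball (0 : E) 1) with hv
  have hv0 : 0 < v := ENNReal.toReal_pos (Metric.measure_ball_pos _ _ one_pos).ne'
    measure_ball_lt_top.ne
  have hcard : ∀ m, ((F m).card : ℝ) ≤ C / v * δ m ^ (-(s : ℝ)) := by
    intro m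
    have h1 := (hFc m).trans (hbd _ (hδ m) (hδle m))
    rw [Measure.addHaar_ball_of_pos _ _ (hδ m), ← ofReal_measureReal measure_ball_lt_top.ne,
      ← ENNReal.ofReal_mul (by have := hδ m; positivity), ← ENNReal.ofReal_natCast,
      ← ENNReal.ofReal_mul (by positivity),
      ENNReal.ofReal_le_ofReal_iff (by have := hδ m; positivity)] at h1
    rw [Real.rpow_sub (hδ m), Real.rpow_natCast] at h1
    have hp : 0 < δ m ^ n := pow_pos (hδ m) n
    have hs : 0 < δ m ^ (s : ℝ) := Real.rpow_pos_of_pos (hδ m) _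
    rw [Real.rpow_neg (hδ m).le]
    rw [← div_eq_mul_inv, div_div, le_div_iff₀ (by positivity)]
    have h2 : ((F m).card : ℝ) * (v * δ m ^ (s : ℝ)) * δ m ^ n ≤ C * δ m ^ n := by
      calc _ = ((F m).card : ℝ) * (δ m ^ n * v) * δ m ^ (s : ℝ) := by ring
        _ ≤ (C * (δ m ^ n / δ m ^ (s : ℝ))) * δ m ^ (s : ℝ) := by gcongr
        _ = _ := by field_simp
    exact le_of_mul_le_mul_right h2 hp
  have hdiam : ∀ m (c : E), Metric.ediam (Metric.closedBall c (2 * δ m)) ≤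
      ENNReal.ofReal (4 * δ m) := by
    intro m c
    refine Metric.ediam_le_of_forall_dist_le fun x hx y hy => ?_
    rw [Metric.mem_closedBall] at hx hy
    linarith [dist_triangle_right x y c]
  refine dimH_le_of_hausdorffMeasure_ne_top (ne_top_of_le_ne_top
    (b := ENNReal.ofReal (C / v * 4 ^ (s : ℝ))) ENNReal.ofReal_ne_top ?_)
  refine (Measure.hausdorffMeasure_le_liminf_sum (l := Filter.atTop) (ι := fun m => F m) (s : ℝ) A
    (fun m => ENNReal.ofReal (4 * δ m)) ?_ (fun m c => Metric.closedBall (c : E) (2 * δ m))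
    (Filter.Eventually.of_forall fun m c => hdiam m c)
    (Filter.Eventually.of_forall fun m => ?_)).trans ?_
  · have := ENNReal.tendsto_ofReal (hδt.const_mul 4)
    simpa using this
  · refine (hFA m).trans (Set.iUnion₂_subset fun c hc => ?_)
    exact Set.subset_iUnion (fun c : F m => Metric.closedBall (c : E) (2 * δ m)) ⟨c, hc⟩
  · refine Filter.liminf_le_of_le (by isBoundedDefault) fun b hb => ?_
    obtain ⟨m, hm⟩ := hb.exists
    refine hm.trans ?_
    calc _ ≤ ∑ _c : F m, ENNReal.ofReal (4 * δ m) ^ (s : ℝ) := by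
          refine Finset.sum_le_sum fun c _ => ?_
          exact ENNReal.rpow_le_rpow (hdiam m c) s.coe_nonneg
      _ = ((F m).card : ℝ≥0∞) * ENNReal.ofReal ((4 * δ m) ^ (s : ℝ)) := by
          rw [ENNReal.ofReal_rpow_of_nonneg (by have := hδ m; positivity) s.coe_nonneg]
          simp
      _ = ENNReal.ofReal ((F m).card * (4 * δ m) ^ (s : ℝ)) := by
          rw [ENNReal.ofReal_mul (by positivity), ENNReal.ofReal_natCast]
      _ ≤ _ := by
          refine ENNReal.ofReal_le_ofReal ?_
          have hp := hδ m
          calc _ ≤ C / v * δ m ^ (-(s : ℝ)) * (4 * δ m) ^ (s : ℝ) := by gcongr; exact hcard m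
            _ = _ := by
              rw [Real.mul_rpow (by norm_num) hp.le, Real.rpow_neg hp.le]
              have : δ m ^ (s : ℝ) ≠ 0 := (Real.rpow_pos_of_pos hp _).ne'
              field_simp

theorem dimH_le_of_hasVolumeBound {A : Set E} {s₀ : ℝ} (h0 : 0 ≤ s₀)
    (h : ∀ s, s₀ < s → HasVolumeBound A s) : dimH A ≤ ENNReal.ofReal s₀ := by
  refine le_of_forall_gt_imp_ge_of_dense fun b hb => ?_
  obtain ⟨s, hs1, hs2⟩ := ENNReal.lt_iff_exists_nnreal_btwn.1 hb
  refine (dimH_le_of_hasVolumeBound_self (h s ?_)).trans hs2.le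
  rw [ENNReal.ofReal_lt_coe_iff h0] at hs1
  exact hs1

end Dimension

/-! ### Upper bounds for regular sets. -/

instance (d : ℕ) : (volume : Measure (EuclideanSpace ℝ (Fin d) ×
    EuclideanSpace ℝ (Fin d))).IsAddHaarMeasure :=
  inferInstanceAs (Measure.prod volume volume).IsAddHaarMeasure

theorem IsRegularSet.hasVolumeBound_unitPairs {d : ℕ} (hd : 1 ≤ d) {α s : ℝ}
    {K : Set (EuclideanSpace ℝ (Fin d))} (hK : IsRegularSet α K) (hs₁ : 2 * α - 1 < s)
    (hs₂ : α + ((d : ℝ) - 1) / 2 < s) : HasVolumeBound (unitPairs K) s := by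
  obtain ⟨n, rfl⟩ := Nat.exists_eq_add_of_le' hd
  obtain ⟨C, hC, h⟩ := hK.isDiscreteAlphaSet.exists_volume_thickening_unitPairs_le
    hK.isCompact.isBounded hs₁ (by push_cast at hs₂; linarith)
  refine ⟨C, hC, 1 / 8, by norm_num, fun δ h0 h1 => (h δ h0 h1).trans (le_of_eq ?_)⟩
  rw [Module.finrank_prod, finrank_euclideanSpace_fin]
  congr 3
  push_cast
  ring

theorem IsDiscreteAlphaSet.dimH_le {d : ℕ} {α : ℝ} (hα : 0 ≤ α)
    {K : Set (EuclideanSpace ℝ (Fin d))} (hK : Bornology.IsBounded K)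
    (h : IsDiscreteAlphaSet α K) : dimH K ≤ ENNReal.ofReal α := by
  obtain ⟨C, hC, hbd⟩ := h.exists_volume_thickening_le hK
  lift α to NNReal using hα
  rw [ENNReal.ofReal_coe_nnreal]
  refine dimH_le_of_hasVolumeBound_self ⟨C, hC, 1, one_pos, fun δ h0 h1 => ?_⟩
  rw [finrank_euclideanSpace_fin]
  exact hbd δ h0 h1

theorem g_le {d : ℕ} (hd : 1 ≤ d) {α s₀ : ℝ} (h0 : 0 ≤ s₀) (hs₁ : 2 * α - 1 ≤ s₀)
    (hs₂ : α + ((d : ℝ) - 1) / 2 ≤ s₀) : g d α ≤ ENNReal.ofReal s₀ := by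
  refine sSup_le ?_
  rintro _ ⟨K, hK, rfl⟩
  exact dimH_le_of_hasVolumeBound h0 fun s hs =>
    hK.hasVolumeBound_unitPairs hd (hs₁.trans_lt hs) (hs₂.trans_lt hs)

/-! ### Ahlfors regular measures and their products. -/

/-- `ν` is a finite measure charging `S`, with `ν (B(x, r)) ≲ r^s` for all `x`, and
`ν (B(x, r)) ≳ r^s` for `x ∈ S` and `r ≤ 1`. -/
structure IsAhlforsRegular {X : Type*} [PseudoMetricSpace X] [MeasurableSpace X] (s : ℝ)
    (S : Set X) (ν : Measure X) : Prop where
  isFiniteMeasure : IsFiniteMeasure ν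
  measure_ne_zero : ν S ≠ 0
  upper : ∃ C : ℝ, 0 ≤ C ∧ ∀ (x : X) (r : ℝ), 0 < r →
    ν (Metric.closedBall x r) ≤ ENNReal.ofReal (C * r ^ s)
  lower : ∃ c : ℝ, 0 < c ∧ ∀ x ∈ S, ∀ r : ℝ, 0 < r → r ≤ 1 →
    ENNReal.ofReal (c * r ^ s) ≤ ν (Metric.closedBall x r)

/-- The mass distribution principle. -/
theorem IsAhlforsRegular.le_dimH {X : Type*} [MetricSpace X] [MeasurableSpace X] [BorelSpace X]
    {s : ℝ} {S : Set X} {ν : Measure X} (h : IsAhlforsRegular s S ν) (hs : 0 < s) :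
    ENNReal.ofReal s ≤ dimH S := by
  obtain ⟨C, hC, hup⟩ := h.upper
  set C' := C + 1 with hC'
  have hC'0 : 0 < C' := by linarith
  have hup' : ∀ (x : X) (r : ℝ), 0 ≤ r →
      ν (Metric.closedBall x r) ≤ ENNReal.ofReal (C' * r ^ s) := by
    intro x r hr
    rcases hr.eq_or_lt with rfl | hr
    -- A set of diameter zero leads to `r = 0`, where the bound is recovered as a limit from larger
    -- balls.
    · have ht : Filter.Tendsto (fun t : ℝ => ENNReal.ofReal (C' * t ^ s)) (𝓝[>] 0)
          (𝓝 (ENNReal.ofReal (C' * 0 ^ s))) :=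
        ENNReal.tendsto_ofReal (((Real.continuousAt_rpow_const 0 s
          (Or.inr hs.le)).tendsto.mono_left nhdsWithin_le_nhds).const_mul C')
      refine ge_of_tendsto ht ?_
      filter_upwards [self_mem_nhdsWithin] with t ht
      have ht0 : 0 < t := ht
      refine (measure_mono (Metric.closedBall_subset_closedBall ht0.le)).trans
        ((hup x t ht0).trans (ENNReal.ofReal_le_ofReal ?_))
      gcongr
      linarith
    · refine (hup x r hr).trans (ENNReal.ofReal_le_ofReal ?_)
      gcongr
      linarith
  have hle : (ENNReal.ofReal C')⁻¹ • ν ≤ Measure.hausdorffMeasure s := by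
    refine Measure.le_hausdorffMeasure s _ 1 one_pos fun U hU => ?_
    rcases U.eq_empty_or_nonempty with rfl | ⟨x, hx⟩
    · simp
    have hfin : Metric.ediam U ≠ ⊤ := (hU.trans_lt ENNReal.one_lt_top).ne
    have hsub : U ⊆ Metric.closedBall x (Metric.ediam U).toReal := by
      intro y hy
      rw [Metric.mem_closedBall, dist_edist]
      exact ENNReal.toReal_mono hfin (Metric.edist_le_ediam_of_mem hy hx)
    have h1 := (measure_mono hsub).trans (hup' x _ ENNReal.toReal_nonneg)
    rw [ENNReal.ofReal_mul hC'0.le, ← ENNReal.ofReal_rpow_of_nonneg ENNReal.toReal_nonneg hs.le,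
      ENNReal.ofReal_toReal hfin] at h1
    rw [Measure.smul_apply, smul_eq_mul]
    rw [ENNReal.inv_mul_le_iff (ENNReal.ofReal_pos.2 hC'0).ne' ENNReal.ofReal_ne_top]
    exact h1
  have hne : Measure.hausdorffMeasure s S ≠ 0 := by
    refine (lt_of_lt_of_le ?_ (hle S)).ne'
    rw [Measure.smul_apply, smul_eq_mul, ENNReal.mul_pos_iff]
    exact ⟨ENNReal.inv_pos.2 ENNReal.ofReal_ne_top, pos_iff_ne_zero.2 h.measure_ne_zero⟩
  lift s to NNReal using hs.le
  rw [ENNReal.ofReal_coe_nnreal]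
  exact le_dimH_of_hausdorffMeasure_ne_zero hne

/-- Balls of the sup metric are products of intervals, so the measures of balls multiply and the
exponents add. -/
theorem IsAhlforsRegular.pi {ι : Type*} [Fintype ι] {γ : ι → ℝ} {S : ι → Set ℝ}
    {ν : ι → Measure ℝ} (h : ∀ i, IsAhlforsRegular (γ i) (S i) (ν i)) :
    IsAhlforsRegular (∑ i, γ i) (Set.univ.pi S) (Measure.pi ν) := by
  have hfin : ∀ i, IsFiniteMeasure (ν i) := fun i => (h i).isFiniteMeasure
  have hpow : ∀ r : ℝ, 0 < r → ∀ C : ι → ℝ, (∀ i, 0 ≤ C i) →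
      ∏ i, ENNReal.ofReal (C i * r ^ γ i) = ENNReal.ofReal ((∏ i, C i) * r ^ ∑ i, γ i) := by
    intro r hr C hC
    rw [← ENNReal.ofReal_prod_of_nonneg fun i _ => by have := hC i; positivity,
      Finset.prod_mul_distrib, Real.rpow_sum_of_pos hr]
  refine ⟨inferInstance, ?_, ?_, ?_⟩
  · rw [Measure.pi_pi]
    exact Finset.prod_ne_zero_iff.2 fun i _ => (h i).measure_ne_zero
  · choose C hC hup using fun i => (h i).upper
    refine ⟨∏ i, C i, Finset.prod_nonneg fun i _ => hC i, fun x r hr => ?_⟩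
    rw [closedBall_pi x hr.le, Measure.pi_pi, ← hpow r hr C hC]
    exact Finset.prod_le_prod' fun i _ => hup i (x i) r hr
  · choose c hc hlow using fun i => (h i).lower
    refine ⟨∏ i, c i, Finset.prod_pos fun i _ => hc i, fun x hx r hr hr1 => ?_⟩
    rw [closedBall_pi x hr.le, Measure.pi_pi, ← hpow r hr c fun i => (hc i).le]
    exact Finset.prod_le_prod' fun i _ => hlow i (x i) (hx i (Set.mem_univ i)) r hr hr1

/-- Double counting of pairs `(z, y)` at distance at most `2δ`, with `z` in the neighbourhood and
the ball, and `y` weighted by `ν`. Each `z` sees mass at least `c δ^s`. Each `y` sees volume at most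
`(4δ)^d`, and only `y` within `r + 2δ ≤ 3r` of `x` contribute. -/
theorem IsAhlforsRegular.exists_volume_thickening_inter_ball_le {d : ℕ} {s : ℝ}
    {S : Set (Fin d → ℝ)} {ν : Measure (Fin d → ℝ)} (h : IsAhlforsRegular s S ν) :
    ∃ C : ℝ, 0 ≤ C ∧ ∀ δ : ℝ, 0 < δ → δ ≤ 1 → ∀ (x : Fin d → ℝ) (r : ℝ), δ ≤ r →
      volume (Metric.thickening δ S ∩ Metric.ball x r) ≤
        ENNReal.ofReal (C * (r / δ) ^ s * δ ^ d) := by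
  have := h.isFiniteMeasure
  obtain ⟨C, hC, hup⟩ := h.upper
  obtain ⟨c, hc, hlow⟩ := h.lower
  refine ⟨C * 3 ^ s * 4 ^ d / c, by positivity, fun δ h0 h1 x r hr => ?_⟩
  have hr0 : 0 < r := h0.trans_le hr
  have hX : 0 < c * δ ^ s := by positivity
  set T : Set ((Fin d → ℝ) × (Fin d → ℝ)) := {p | dist p.1 p.2 ≤ 2 * δ} with hT
  have hTm : MeasurableSet T := measurableSet_le (by fun_prop) measurable_const
  have key : ENNReal.ofReal (c * δ ^ s) * volume (Metric.thickening δ S ∩ Metric.ball x r) ≤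
      ENNReal.ofReal (C * (3 * r) ^ s * (4 * δ) ^ d) := by
    calc _ = ∫⁻ _ in Metric.thickening δ S ∩ Metric.ball x r, ENNReal.ofReal (c * δ ^ s) := by
          rw [setLIntegral_const]
      _ ≤ ∫⁻ z in Metric.thickening δ S ∩ Metric.ball x r, ν (Prod.mk z ⁻¹' T) := by
          refine setLIntegral_mono' (Metric.isOpen_thickening.measurableSet.inter
            measurableSet_ball) fun z hz => ?_
          obtain ⟨k, hk, hzk⟩ := Metric.mem_thickening_iff.1 hz.1
          refine (hlow k hk δ h0 h1).trans (measure_mono fun y hy => ?_)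
          rw [Metric.mem_closedBall] at hy
          change dist z y ≤ 2 * δ
          linarith [dist_triangle_right z y k]
      _ ≤ ∫⁻ z in Metric.ball x r, ν (Prod.mk z ⁻¹' T) :=
          lintegral_mono_set Set.inter_subset_right
      _ = ∫⁻ y, volume.restrict (Metric.ball x r) ((fun z => (z, y)) ⁻¹' T) ∂ν := by
          rw [← Measure.prod_apply hTm, Measure.prod_apply_symm hTm]
      _ ≤ ∫⁻ y, (Metric.closedBall x (3 * r)).indicator
            (fun _ => ENNReal.ofReal ((4 * δ) ^ d)) y ∂ν := by
          refine lintegral_mono fun y => ?_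
          by_cases hy : y ∈ Metric.closedBall x (3 * r)
          · rw [Set.indicator_of_mem hy]
            have hvol : volume (Metric.closedBall y (2 * δ)) = ENNReal.ofReal ((4 * δ) ^ d) := by
              rw [Real.volume_pi_closedBall _ (by positivity), Fintype.card_fin]
              congr 2; ring
            rw [← hvol]
            exact (Measure.restrict_apply_le _ _).trans (measure_mono fun z hz => hz)
          · rw [Set.indicator_of_notMem hy]
            refine le_of_eq ?_
            rw [Measure.restrict_apply (measurable_prodMk_right hTm)]
            refine measure_mono_null (t := ∅) ?_ measure_empty
            rintro z ⟨hz1, hz2⟩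
            refine hy ?_
            have hz1' : dist z y ≤ 2 * δ := hz1
            rw [Metric.mem_ball] at hz2
            rw [Metric.mem_closedBall]
            linarith [dist_triangle_left y x z]
      _ = ENNReal.ofReal ((4 * δ) ^ d) * ν (Metric.closedBall x (3 * r)) := by
          rw [lintegral_indicator measurableSet_closedBall, setLIntegral_const]
      _ ≤ ENNReal.ofReal ((4 * δ) ^ d) * ENNReal.ofReal (C * (3 * r) ^ s) := by
          gcongr
          exact hup x _ (by positivity)
      _ = _ := by
          rw [← ENNReal.ofReal_mul (by positivity)]
          congr 1; ring
  rw [mul_comm, ← ENNReal.le_div_iff_mul_le (Or.inl (ENNReal.ofReal_pos.2 hX).ne')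
    (Or.inl ENNReal.ofReal_ne_top), ← ENNReal.ofReal_div_of_pos hX] at key
  refine key.trans (ENNReal.ofReal_le_ofReal (le_of_eq ?_))
  rw [Real.mul_rpow (by norm_num) hr0.le, Real.div_rpow hr0.le h0.le, mul_pow]
  have : δ ^ s ≠ 0 := (Real.rpow_pos_of_pos h0 s).ne'
  field_simp

/-- Lebesgue measure on an interval is regular of exponent one. -/
theorem isAhlforsRegular_Icc {ε : ℝ} (hε : 0 < ε) :
    IsAhlforsRegular 1 (Set.Icc 0 ε) (volume.restrict (Set.Icc (0 : ℝ) ε)) := by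
  refine ⟨inferInstance, by simp [hε], ⟨2, by norm_num, fun x r hr => ?_⟩,
    ⟨min 1 ε, by positivity, fun x hx r hr hr1 => ?_⟩⟩
  · refine (Measure.restrict_apply_le _ _).trans (le_of_eq ?_)
    rw [Real.volume_closedBall, Real.rpow_one]
  · set t := min 1 ε * r with ht
    have ht0 : 0 ≤ t := by positivity
    have htr : t ≤ r := mul_le_of_le_one_left hr.le (min_le_left _ _)
    have htε : t ≤ ε := (mul_le_of_le_one_right (by positivity) hr1).trans (min_le_right _ _)
    rw [Real.rpow_one, Measure.restrict_apply measurableSet_closedBall, Real.closedBall_eq_Icc,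
      Set.Icc_inter_Icc, Real.volume_Icc]
    refine ENNReal.ofReal_le_ofReal ?_
    rcases le_total (x - r) 0 with h1 | h1 <;> rcases le_total (x + r) ε with h2 | h2 <;>
      simp only [h1, h2, sup_of_le_left, sup_of_le_right, inf_of_le_left, inf_of_le_right] <;>
      linarith [hx.1, hx.2]

/-! ### Cantor sets of prescribed dimension on the line. -/

section Cantor

variable {ρ : ℝ}

theorem cantorFunction_nonneg (h0 : 0 ≤ ρ) (ω : ℕ → Bool) : 0 ≤ Cardinal.cantorFunction ρ ω :=
  tsum_nonneg fun _ => Cardinal.cantorFunctionAux_nonneg h0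

theorem cantorFunction_le_inv (h0 : 0 ≤ ρ) (h1 : ρ < 1) (ω : ℕ → Bool) :
    Cardinal.cantorFunction ρ ω ≤ (1 - ρ)⁻¹ := by
  rw [← tsum_geometric_of_lt_one h0 h1]
  refine (Cardinal.summable_cantor_function ω h0 h1).tsum_le_tsum (fun n => ?_)
    (summable_geometric_of_lt_one h0 h1)
  have : 0 ≤ ρ ^ n := by positivity
  cases h : ω n <;> simp [h, this]

theorem abs_cantorFunction_sub_le (h0 : 0 ≤ ρ) (h1 : ρ < 1) (n : ℕ) (ω ω' : ℕ → Bool)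
    (h : ∀ i < n, ω i = ω' i) :
    |Cardinal.cantorFunction ρ ω - Cardinal.cantorFunction ρ ω'| ≤ ρ ^ n * (1 - ρ)⁻¹ := by
  induction n generalizing ω ω' with
  | zero =>
    rw [pow_zero, one_mul, abs_le]
    have := cantorFunction_nonneg h0 ω
    have := cantorFunction_nonneg h0 ω'
    have := cantorFunction_le_inv h0 h1 ω
    have := cantorFunction_le_inv h0 h1 ω'
    constructor <;> linarith
  | succ n ih =>
    rw [Cardinal.cantorFunction_succ ω h0 h1, Cardinal.cantorFunction_succ ω' h0 h1,
      h 0 (Nat.succ_pos n), add_sub_add_left_eq_sub, ← mul_sub, abs_mul, abs_of_nonneg h0,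
      pow_succ', mul_assoc]
    exact mul_le_mul_of_nonneg_left
      (ih _ _ fun i hi => h (i + 1) (Nat.succ_lt_succ hi)) h0

/-- At the first differing digit the leading terms differ by `1`, while all later digits together
contribute at most `ρ/(1-ρ) < 1`. Each common digit before it scales the difference by `ρ`. -/
theorem le_abs_cantorFunction_sub (h0 : 0 ≤ ρ) (h1 : ρ < 1 / 2) (n : ℕ) (ω ω' : ℕ → Bool)
    (h : ¬ ∀ i < n + 1, ω i = ω' i) :
    ρ ^ n * (1 - ρ * (1 - ρ)⁻¹) ≤
      |Cardinal.cantorFunction ρ ω - Cardinal.cantorFunction ρ ω'| := by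
  have h1' : ρ < 1 := by linarith
  have hκ : 0 ≤ 1 - ρ * (1 - ρ)⁻¹ := by
    rw [sub_nonneg, ← div_eq_mul_inv, div_le_one (by linarith)]
    linarith
  induction n generalizing ω ω' with
  | zero =>
    have hne : ω 0 ≠ ω' 0 := fun he => h fun i hi => by
      rw [Nat.lt_one_iff.1 hi]; exact he
    have hd := abs_cantorFunction_sub_le h0 h1' 0 (fun i => ω (i + 1)) (fun i => ω' (i + 1))
      (by simp)
    rw [pow_zero, one_mul] at hd ⊢
    have hd' : |ρ * (Cardinal.cantorFunction ρ (fun i => ω (i + 1)) -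
        Cardinal.cantorFunction ρ fun i => ω' (i + 1))| ≤ ρ * (1 - ρ)⁻¹ := by
      rw [abs_mul, abs_of_nonneg h0]; exact mul_le_mul_of_nonneg_left hd h0
    rw [Cardinal.cantorFunction_succ ω h0 h1', Cardinal.cantorFunction_succ ω' h0 h1',
      add_sub_add_comm, ← mul_sub]
    rw [abs_le] at hd'
    cases hω : ω 0 <;> cases hω' : ω' 0
    · exact absurd (hω.trans hω'.symm) hne
    · refine le_abs.2 (Or.inr ?_)
      simp only [cond_false, cond_true]
      linarith [hd'.2]
    · refine le_abs.2 (Or.inl ?_)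
      simp only [cond_false, cond_true]
      linarith [hd'.1]
    · exact absurd (hω.trans hω'.symm) hne
  | succ n ih =>
    by_cases he : ω 0 = ω' 0
    · rw [Cardinal.cantorFunction_succ ω h0 h1', Cardinal.cantorFunction_succ ω' h0 h1',
        he, add_sub_add_left_eq_sub, ← mul_sub, abs_mul, abs_of_nonneg h0,
        pow_succ', mul_assoc]
      refine mul_le_mul_of_nonneg_left (ih _ _ fun hall => h fun i hi => ?_) h0
      rcases i with _ | i
      · exact he
      · exact hall i (Nat.succ_lt_succ_iff.1 hi)
    · have := ih ω ω' fun hall => he (hall 0 (Nat.succ_pos n))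
      refine le_trans ?_ this
      refine mul_le_mul_of_nonneg_right ?_ hκ
      exact pow_le_pow_of_le_one h0 h1'.le (Nat.le_succ n)

theorem continuous_cantorFunction (h0 : 0 ≤ ρ) (h1 : ρ < 1) :
    Continuous (Cardinal.cantorFunction ρ) := by
  refine continuous_tsum (u := fun n => ρ ^ n) (fun n => ?_) (summable_geometric_of_lt_one h0 h1)
    fun n ω => ?_
  · exact (continuous_of_discreteTopology (f := fun b : Bool => cond b (ρ ^ n) 0)).comp
      (continuous_apply n)
  · have : 0 ≤ ρ ^ n := by positivity
    cases h : ω n <;> simp [h, this, abs_of_nonneg h0]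

/-- The law of a sequence of independent fair coins. -/
def coinMeasure : Measure (ℕ → Bool) :=
  Measure.infinitePi fun _ => (PMF.uniformOfFintype Bool).toMeasure

instance : IsProbabilityMeasure coinMeasure := by
  unfold coinMeasure; infer_instance

theorem coinMeasure_cylinder (ω : ℕ → Bool) (n : ℕ) :
    coinMeasure {ω' | ∀ i < n, ω' i = ω i} = ENNReal.ofReal ((1 / 2) ^ n) := by
  have h : {ω' : ℕ → Bool | ∀ i < n, ω' i = ω i} =
      Set.pi (Finset.range n : Set ℕ) fun i => {ω i} := by
    ext ω'; simp [Set.mem_pi]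
  rw [h, coinMeasure, Measure.infinitePi_pi _ fun i _ => measurableSet_singleton _]
  simp only [PMF.toMeasure_apply_singleton _ _ (measurableSet_singleton _),
    PMF.uniformOfFintype_apply, Fintype.card_bool, Finset.prod_const, Finset.card_range]
  rw [ENNReal.ofReal_pow (by norm_num), one_div, ENNReal.ofReal_inv_of_pos (by norm_num)]
  simp

/-- A map from coin sequences to the line which contracts and separates cylinders of length `n` at
scale `ρ^n`, `ρ^γ = 1/2`, carries the coin measure to a regular measure of exponent `γ`. -/
theorem isAhlforsRegular_map_coinMeasure {γ ε c : ℝ} (hγ : 0 < γ) (hρ0 : 0 < ρ) (hρ1 : ρ < 1)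
    (hργ : ρ ^ γ = 1 / 2) (hε : 0 < ε) (hc : 0 < c) {φ : (ℕ → Bool) → ℝ} (hφ : Measurable φ)
    (hle : ∀ (n : ℕ) (ω ω' : ℕ → Bool), (∀ i < n, ω i = ω' i) → |φ ω - φ ω'| ≤ ε * ρ ^ n)
    (hge : ∀ (n : ℕ) (ω ω' : ℕ → Bool), (¬ ∀ i < n + 1, ω i = ω' i) →
      c * ρ ^ n ≤ |φ ω - φ ω'|) :
    IsAhlforsRegular γ (Set.range φ) (coinMeasure.map φ) := by
  have hhalf : ∀ n : ℕ, (1 / 2 : ℝ) ^ n = (ρ ^ n) ^ γ := fun n => by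
    rw [← hργ, ← Real.rpow_natCast, ← Real.rpow_natCast, ← Real.rpow_mul hρ0.le,
      ← Real.rpow_mul hρ0.le, mul_comm]
  have hprob : IsProbabilityMeasure (coinMeasure.map φ) :=
    Measure.isProbabilityMeasure_map hφ.aemeasurable
  refine ⟨inferInstance, ?_, ⟨(4 / c) ^ γ, by positivity, fun x r hr => ?_⟩,
    ⟨min 1 ((1 / 2) * (1 / ε) ^ γ), by positivity, ?_⟩⟩
  · intro h0
    have h1 := Measure.le_map_apply (μ := coinMeasure) hφ.aemeasurable (Set.range φ)
    rw [Set.preimage_range, measure_univ, h0] at h1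
    simp at h1
  · rw [← Real.mul_rpow (by positivity) hr.le]
    rcases le_or_gt (4 / c * r) 1 with hsmall | hbig
    -- Here `ρ^(n+1) < 4r/c ≤ ρ^n`. Two sequences differing among the first `n + 1` digits have
    -- images at least `4r` apart, so the preimage of a ball of radius `r` lies in one cylinder.
    · obtain ⟨n, hn1, hn2⟩ := exists_nat_pow_near_of_lt_one (by positivity : 0 < 4 / c * r) hsmall
        hρ0 hρ1
      rw [Measure.map_apply hφ measurableSet_closedBall]
      rcases (φ ⁻¹' Metric.closedBall x r).eq_empty_or_nonempty with he | ⟨ω, hω⟩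
      · rw [he, measure_empty]; exact zero_le
      calc coinMeasure (φ ⁻¹' Metric.closedBall x r)
          ≤ coinMeasure {ω' | ∀ i < n + 1, ω' i = ω i} := by
            refine measure_mono fun ω' hω' => ?_
            by_contra hcon
            have h1 := hge n ω' ω hcon
            have h2 : |φ ω' - φ ω| ≤ 2 * r := by
              have h3 : dist (φ ω') x ≤ r := hω'
              have h4 : dist (φ ω) x ≤ r := hω
              have h5 := dist_triangle_right (φ ω') (φ ω) x
              rw [Real.dist_eq (φ ω') (φ ω)] at h5
              linarith
            have h6 : 4 * r ≤ c * ρ ^ n := by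
              calc 4 * r = c * (4 / c * r) := by field_simp
                _ ≤ c * ρ ^ n := by gcongr
            linarith
        _ = ENNReal.ofReal ((1 / 2) ^ (n + 1)) := coinMeasure_cylinder ω (n + 1)
        _ ≤ _ := by
            refine ENNReal.ofReal_le_ofReal ?_
            rw [hhalf]
            exact Real.rpow_le_rpow (by positivity) hn1.le hγ.le
    · refine prob_le_one.trans ?_
      rw [← ENNReal.ofReal_one]
      exact ENNReal.ofReal_le_ofReal (Real.one_le_rpow hbig.le hγ.le)
  · rintro _ ⟨ω, rfl⟩ r hr hr1
    have hcyl : ∀ n : ℕ, ε * ρ ^ n ≤ r →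
        ENNReal.ofReal ((1 / 2) ^ n) ≤ coinMeasure.map φ (Metric.closedBall (φ ω) r) := by
      intro n hn
      rw [Measure.map_apply hφ measurableSet_closedBall, ← coinMeasure_cylinder ω n]
      exact measure_mono fun ω' hω' => (hle n ω' ω hω').trans hn
    have hrp : 0 ≤ r ^ γ := by positivity
    rcases le_or_gt ε r with hbig | hsmall
    · refine le_trans (ENNReal.ofReal_le_ofReal ?_) (hcyl 0 (by simpa using hbig))
      rw [pow_zero]
      exact mul_le_one₀ (min_le_left _ _) hrp (Real.rpow_le_one hr.le hr1 hγ.le)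
    -- Now `ρ^(n+1) < r/ε ≤ ρ^n`: the cylinder of length `n + 1` fits in the ball, and the extra
    -- digit costs the factor `1/2`.
    · obtain ⟨n, hn1, hn2⟩ := exists_nat_pow_near_of_lt_one (by positivity : 0 < r / ε)
        ((div_le_one hε).2 hsmall.le) hρ0 hρ1
      have h1 : ε * ρ ^ (n + 1) ≤ r := by
        rw [lt_div_iff₀ hε] at hn1; linarith
      refine le_trans (ENNReal.ofReal_le_ofReal ?_) (hcyl (n + 1) h1)
      calc min 1 ((1 / 2) * (1 / ε) ^ γ) * r ^ γ ≤ (1 / 2) * (1 / ε) ^ γ * r ^ γ := by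
            gcongr; exact min_le_right _ _
        _ = (r / ε) ^ γ * (1 / 2) := by
            rw [mul_assoc, ← Real.mul_rpow (by positivity) hr.le, mul_comm]
            congr 2; ring
        _ ≤ (ρ ^ n) ^ γ * (1 / 2) := by gcongr
        _ = _ := by rw [← hhalf, pow_succ]

/-- For `γ < 1` the ratio `ρ = 2^(-1/γ)` is below `1/2`, so cylinders separate. At `γ = 1`
separation fails, and an interval is used instead. -/
theorem exists_isAhlforsRegular {γ ε : ℝ} (hγ0 : 0 < γ) (hγ1 : γ ≤ 1) (hε : 0 < ε) :
    ∃ (S : Set ℝ) (ν : Measure ℝ), IsCompact S ∧ S ⊆ Set.Icc 0 ε ∧ IsAhlforsRegular γ S ν := by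
  rcases hγ1.eq_or_lt with rfl | hγ1
  · exact ⟨_, _, isCompact_Icc, subset_rfl, isAhlforsRegular_Icc hε⟩
  set ρ : ℝ := (1 / 2) ^ (1 / γ) with hρ
  have hρ0 : 0 < ρ := by positivity
  have hρh : ρ < 1 / 2 := by
    conv_rhs => rw [← Real.rpow_one (1 / 2)]
    exact Real.rpow_lt_rpow_of_exponent_gt (by norm_num) (by norm_num)
      ((one_lt_div hγ0).2 hγ1)
  have hρ1 : ρ < 1 := by linarith
  have hργ : ρ ^ γ = 1 / 2 := by
    rw [hρ, ← Real.rpow_mul (by norm_num), one_div_mul_cancel hγ0.ne', Real.rpow_one]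
  have h1ρ : 0 < 1 - ρ := by linarith
  -- The factor `ε (1-ρ)` scales the range into `[0, ε]`. The separation constant becomes `ε (1-ρ)(1
  -- - ρ/(1-ρ)) = ε (1-2ρ)`.
  set φ : (ℕ → Bool) → ℝ := fun ω => ε * (1 - ρ) * Cardinal.cantorFunction ρ ω with hφ
  have hφc : Continuous φ := continuous_const.mul (continuous_cantorFunction hρ0.le hρ1)
  have hsub : ∀ ω ω', |φ ω - φ ω'| = ε * (1 - ρ) *
      |Cardinal.cantorFunction ρ ω - Cardinal.cantorFunction ρ ω'| := fun ω ω' => by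
    rw [hφ, ← mul_sub, abs_mul, abs_of_pos (by positivity)]
  refine ⟨Set.range φ, coinMeasure.map φ, isCompact_range hφc, ?_,
    isAhlforsRegular_map_coinMeasure hγ0 hρ0 hρ1 hργ hε (c := ε * (1 - 2 * ρ))
      (mul_pos hε (by linarith)) hφc.measurable ?_ ?_⟩
  · rintro _ ⟨ω, rfl⟩
    refine ⟨mul_nonneg (by positivity) (cantorFunction_nonneg hρ0.le ω), ?_⟩
    calc φ ω ≤ ε * (1 - ρ) * (1 - ρ)⁻¹ :=
          mul_le_mul_of_nonneg_left (cantorFunction_le_inv hρ0.le hρ1 ω) (by positivity)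
      _ = ε := by field_simp
  · intro n ω ω' h
    rw [hsub]
    calc _ ≤ ε * (1 - ρ) * (ρ ^ n * (1 - ρ)⁻¹) := by
          gcongr; exact abs_cantorFunction_sub_le hρ0.le hρ1 n ω ω' h
      _ = _ := by field_simp
  · intro n ω ω' h
    rw [hsub]
    calc ε * (1 - 2 * ρ) * ρ ^ n = ε * (1 - ρ) * (ρ ^ n * (1 - ρ * (1 - ρ)⁻¹)) := by
          field_simp; ring
      _ ≤ _ := by
          gcongr; exact le_abs_cantorFunction_sub hρ0.le hρh n ω ω' h

end Cantor

/-! ### Extremal product sets and the lower bound. -/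

/-- The product set `∏ S i` in Euclidean space. -/
def euclideanPi {d : ℕ} (S : Fin d → Set ℝ) : Set (EuclideanSpace ℝ (Fin d)) :=
  {x | ∀ i, x i ∈ S i}

theorem isCompact_euclideanPi {d : ℕ} {S : Fin d → Set ℝ} (hS : ∀ i, IsCompact (S i)) :
    IsCompact (euclideanPi S) := by
  have h := (isCompact_univ_pi hS).image
    (PiLp.continuous_toLp 2 (fun _ : Fin d => ℝ))
  convert! h using 1
  ext x
  simp only [euclideanPi, Set.mem_ofPred_eq, Set.mem_image, Set.mem_univ_pi]
  exact ⟨fun hx => ⟨x.ofLp, hx, rfl⟩, by rintro ⟨y, hy, rfl⟩; exact hy⟩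

theorem isDiscreteAlphaSet_euclideanPi {d : ℕ} {S : Fin d → Set ℝ} {γ : Fin d → ℝ}
    {ν : Fin d → Measure ℝ} (h : ∀ i, IsAhlforsRegular (γ i) (S i) (ν i)) :
    IsDiscreteAlphaSet (∑ i, γ i) (euclideanPi S) := by
  obtain ⟨C, hC, hbd⟩ := (IsAhlforsRegular.pi h).exists_volume_thickening_inter_ball_le
  refine ⟨C, fun δ h0 h1 x r hr => le_trans ?_ (hbd δ h0 h1 x.ofLp r hr)⟩
  have hdist : ∀ y z : EuclideanSpace ℝ (Fin d), dist y.ofLp z.ofLp ≤ dist y z := fun y z => by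
    simpa using (PiLp.lipschitzWith_ofLp 2 (fun _ : Fin d => ℝ)).dist_le_mul y z
  rw [← (PiLp.volume_preserving_ofLp (Fin d)).measure_preimage
    (Metric.isOpen_thickening.measurableSet.inter measurableSet_ball).nullMeasurableSet]
  refine measure_mono fun y hy => ⟨?_, (hdist y x).trans_lt hy.2⟩
  obtain ⟨z, hz, hyz⟩ := Metric.mem_thickening_iff.1 hy.1
  exact Metric.mem_thickening_iff.2 ⟨z.ofLp, fun i _ => hz i, (hdist y z).trans_lt hyz⟩

/-- Discreteness already bounds the dimension above. The mass distribution principle bounds it below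
in the sup metric, and the identity from the Euclidean to the sup metric is 1-Lipschitz. -/
theorem isRegularSet_euclideanPi {d : ℕ} {S : Fin d → Set ℝ} {γ : Fin d → ℝ}
    {ν : Fin d → Measure ℝ} (hS : ∀ i, IsCompact (S i))
    (h : ∀ i, IsAhlforsRegular (γ i) (S i) (ν i)) (hγ : 0 < ∑ i, γ i) :
    IsRegularSet (∑ i, γ i) (euclideanPi S) := by
  have hdisc := isDiscreteAlphaSet_euclideanPi h
  have hcomp := isCompact_euclideanPi hS
  refine ⟨hcomp, le_antisymm (hdisc.dimH_le hγ.le hcomp.isBounded) ?_, hdisc⟩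
  refine ((IsAhlforsRegular.pi h).le_dimH hγ).trans ?_
  refine le_trans (dimH_mono ?_)
    ((PiLp.lipschitzWith_ofLp 2 (fun _ : Fin d => ℝ)).dimH_image_le (euclideanPi S))
  exact fun y hy => ⟨WithLp.toLp 2 y, fun i => hy i (Set.mem_univ i), rfl⟩

/-- Forgetting the first coordinate of the second point of a pair. -/
def pairCoords {n : ℕ} (p : EuclideanSpace ℝ (Fin (n + 1)) × EuclideanSpace ℝ (Fin (n + 1))) :
    Fin (n + 1) ⊕ Fin n → ℝ :=
  Sum.elim (fun i => p.1 i) fun i => p.2 i.succ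

theorem lipschitzWith_pairCoords {n : ℕ} : LipschitzWith 1 (pairCoords (n := n)) := by
  refine LipschitzWith.of_dist_le_mul fun p q => ?_
  rw [NNReal.coe_one, one_mul]
  have hcoord : ∀ (x y : EuclideanSpace ℝ (Fin (n + 1))) i, dist (x i) (y i) ≤ dist x y := by
    intro x y i
    rw [dist_eq_norm, dist_eq_norm]
    exact PiLp.norm_apply_le (x - y) i
  refine (dist_pi_le_iff dist_nonneg).2 fun i => ?_
  rw [Prod.dist_eq]
  rcases i with i | i
  · exact (hcoord p.1 q.1 i).trans (le_max_left _ _)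
  · exact (hcoord p.2 q.2 i.succ).trans (le_max_right _ _)

/-- Over a product set with an interval as first factor and the other factors `T` small, the pairs
at unit distance project onto `[0, 1] × T^n × T^n`. -/
theorem pi_subset_pairCoords_image {n : ℕ} {T : Set ℝ}
    (hT : T ⊆ Set.Icc 0 (1 / ((n : ℝ) + 1))) :
    Set.univ.pi (Sum.elim (Fin.cons (Set.Icc 0 1) fun _ => T) (fun _ : Fin n => T)) ⊆
      pairCoords '' unitPairs (euclideanPi (Fin.cons (Set.Icc 0 2) fun _ : Fin n => T)) := by
  intro z hz
  have hz0 : z (Sum.inl 0) ∈ Set.Icc (0 : ℝ) 1 := hz (Sum.inl 0) (Set.mem_univ _)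
  have hz1 : ∀ i : Fin n, z (Sum.inl i.succ) ∈ T := fun i => hz (Sum.inl i.succ) (Set.mem_univ _)
  have hz2 : ∀ i : Fin n, z (Sum.inr i) ∈ T := fun i => hz (Sum.inr i) (Set.mem_univ _)
  set Q : ℝ := ∑ i : Fin n, (z (Sum.inr i) - z (Sum.inl i.succ)) ^ 2 with hQ
  have hQ0 : 0 ≤ Q := Finset.sum_nonneg fun i _ => sq_nonneg _
  have hQ1 : Q ≤ 1 := by
    have hterm : ∀ i ∈ (Finset.univ : Finset (Fin n)),
        (z (Sum.inr i) - z (Sum.inl i.succ)) ^ 2 ≤ 1 / ((n : ℝ) + 1) := by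
      intro i _
      have h1 := hT (hz1 i)
      have h2 := hT (hz2 i)
      have h3 : 1 / ((n : ℝ) + 1) ≤ 1 := by
        rw [div_le_one (by positivity)]; linarith [n.cast_nonneg (α := ℝ)]
      have h4 : |z (Sum.inr i) - z (Sum.inl i.succ)| ≤ 1 / ((n : ℝ) + 1) :=
        abs_le.2 ⟨by linarith [h1.2, h2.1], by linarith [h1.1, h2.2]⟩
      rw [← sq_abs]
      nlinarith [abs_nonneg (z (Sum.inr i) - z (Sum.inl i.succ))]
    calc Q ≤ ∑ _i : Fin n, 1 / ((n : ℝ) + 1) := Finset.sum_le_sum hterm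
      _ = n / ((n : ℝ) + 1) := by simp [div_eq_mul_inv]
      _ ≤ 1 := by rw [div_le_one (by positivity)]; linarith
  -- The gap in the first coordinate that makes the distance exactly one. Since `0 ≤ t ≤ 1`,
  -- starting in `[0,1]` ends in `[0,2]`; this is why the first factor of the set is twice as long
  -- as the projected interval.
  set t : ℝ := Real.sqrt (1 - Q) with ht
  have ht2 : t ^ 2 = 1 - Q := Real.sq_sqrt (by linarith)
  have ht0 : 0 ≤ t := Real.sqrt_nonneg _
  have ht1 : t ≤ 1 := Real.sqrt_le_one.2 (by linarith)
  refine ⟨(WithLp.toLp 2 fun i => z (Sum.inl i),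
    WithLp.toLp 2 (Fin.cons (z (Sum.inl 0) + t) fun i => z (Sum.inr i))), ⟨?_, ?_, ?_⟩, ?_⟩
  · intro i
    refine Fin.cases ?_ (fun j => ?_) i
    · exact ⟨hz0.1, by linarith [hz0.2]⟩
    · exact hz1 j
  · intro i
    refine Fin.cases ?_ (fun j => ?_) i
    · exact ⟨add_nonneg hz0.1 ht0, show z (Sum.inl 0) + t ≤ 2 by linarith [hz0.2]⟩
    · exact hz2 j
  · rw [← sq_eq_sq₀ (norm_nonneg _) zero_le_one, EuclideanSpace.norm_sq_eq, Fin.sum_univ_succ]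
    simp only [PiLp.sub_apply, Fin.cons_zero, Fin.cons_succ, Real.norm_eq_abs, sq_abs]
    rw [add_sub_cancel_left, ht2, ← hQ]
    norm_num
  · funext i
    rcases i with i | i <;> simp [pairCoords]

theorem le_g {d : ℕ} (hd : 1 ≤ d) {α : ℝ} (h1 : ((d : ℝ) + 1) / 2 ≤ α) (h2 : α ≤ d) :
    ENNReal.ofReal (2 * α - 1) ≤ g d α := by
  obtain ⟨n, rfl⟩ := Nat.exists_eq_add_of_le' hd
  push_cast at h1 h2
  -- In dimension one the range forces `α = 1`, and `γ` is irrelevant. Otherwise `γ = (α-1)/n`,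
  -- positive because `(d+1)/2 > 1` and at most one because `α ≤ d`.
  obtain ⟨γ, hγ0, hγ1, hαγ⟩ : ∃ γ : ℝ, 0 < γ ∧ γ ≤ 1 ∧ α = 1 + n * γ := by
    rcases n.eq_zero_or_pos with rfl | hn
    · refine ⟨1, one_pos, le_rfl, ?_⟩
      norm_num at h1 h2 ⊢
      linarith
    · have hn' : (0 : ℝ) < n := by exact_mod_cast hn
      refine ⟨(α - 1) / n, div_pos (by linarith) hn', (div_le_one hn').2 (by linarith), ?_⟩
      field_simp
      ring
  obtain ⟨T, ν, hTc, hTsub, hT⟩ := exists_isAhlforsRegular hγ0 hγ1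
    (by positivity : (0 : ℝ) < 1 / ((n : ℝ) + 1))
  have hcons : ∀ ε : ℝ, 0 < ε → ∀ i : Fin (n + 1),
      IsAhlforsRegular ((Fin.cons 1 fun _ => γ : Fin (n + 1) → ℝ) i)
        ((Fin.cons (Set.Icc 0 ε) fun _ => T : Fin (n + 1) → Set ℝ) i)
        ((Fin.cons (volume.restrict (Set.Icc 0 ε)) fun _ => ν : Fin (n + 1) → Measure ℝ) i) := by
    intro ε hε i
    refine Fin.cases ?_ (fun j => ?_) i
    · exact isAhlforsRegular_Icc hε
    · exact hT
  have hsum : ∑ i, (Fin.cons 1 fun _ => γ : Fin (n + 1) → ℝ) i = α := by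
    rw [Fin.sum_univ_succ, hαγ]; simp
  have hα : 0 < α := by rw [hαγ]; positivity
  have hreg : IsRegularSet α (euclideanPi (Fin.cons (Set.Icc 0 2) fun _ : Fin n => T)) := by
    rw [← hsum]
    refine isRegularSet_euclideanPi (fun i => ?_) (hcons 2 two_pos) (by rwa [hsum])
    refine Fin.cases ?_ (fun j => ?_) i
    · exact isCompact_Icc
    · exact hTc
  have hpair := IsAhlforsRegular.pi (ι := Fin (n + 1) ⊕ Fin n)
    (γ := Sum.elim (Fin.cons 1 fun _ => γ) fun _ => γ)
    (S := Sum.elim (Fin.cons (Set.Icc 0 1) fun _ => T) fun _ => T)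
    (ν := Sum.elim (Fin.cons (volume.restrict (Set.Icc 0 1)) fun _ => ν) fun _ => ν) (by
      rintro (i | i)
      · exact hcons 1 one_pos i
      · exact hT)
  -- The dimension count is `1 + nγ + nγ = 2(1 + nγ) - 1`.
  have hsum' : ∑ i, (Sum.elim (Fin.cons 1 fun _ => γ) fun _ => γ : Fin (n + 1) ⊕ Fin n → ℝ) i =
      2 * α - 1 := by
    rw [Fintype.sum_sum_type]
    simp only [Sum.elim_inl, Sum.elim_inr]
    rw [hsum, hαγ]
    simp
    ring
  rw [hsum'] at hpair
  calc ENNReal.ofReal (2 * α - 1) ≤ _ :=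
        hpair.le_dimH (by rw [hαγ]; nlinarith [n.cast_nonneg (α := ℝ)])
    _ ≤ _ := dimH_mono (pi_subset_pairCoords_image hTsub)
    _ ≤ _ := lipschitzWith_pairCoords.dimH_image_le _
    _ ≤ g (n + 1) α := by
        unfold g
        exact le_sSup ⟨_, hreg, rfl⟩

end UnitDistance

end

theorem theorem2 (d : ℕ) (hd : 1 ≤ d) (α : ℝ) (hα : 0 ≤ α) :
    (((d : ℝ) + 1) / 2 ≤ α → α ≤ d →
      UnitDistance.g d α = ENNReal.ofReal (2 * α - 1) ∧
      ∀ K : Set (EuclideanSpace ℝ (Fin d)), UnitDistance.IsRegularSet α K →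
        UnitDistance.upperMinkowskiDim (UnitDistance.unitPairs K) ≤ ((2 * α - 1 : ℝ) : EReal)) ∧
    (α ≤ ((d : ℝ) + 1) / 2 →
      UnitDistance.g d α ≤ ENNReal.ofReal (α + ((d : ℝ) - 1) / 2) ∧
      ∀ K : Set (EuclideanSpace ℝ (Fin d)), UnitDistance.IsRegularSet α K →
        UnitDistance.upperMinkowskiDim (UnitDistance.unitPairs K) ≤
          ((α + ((d : ℝ) - 1) / 2 : ℝ) : EReal)) := by
  have hd' : (1 : ℝ) ≤ d := by exact_mod_cast hd
  -- The exponents `2α - 1` and `α + (d-1)/2` cross at `α = (d+1)/2`, so in each range the claimed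
  -- one is the larger and satisfies both requirements on `s`.
  refine ⟨fun h1 h2 => ⟨le_antisymm (UnitDistance.g_le hd (by linarith) le_rfl (by linarith))
      (UnitDistance.le_g hd h1 h2),
    fun K hK => UnitDistance.upperMinkowskiDim_le_of_hasVolumeBound fun s hs =>
      hK.hasVolumeBound_unitPairs hd hs (by linarith)⟩, fun h1 =>
    ⟨UnitDistance.g_le hd (by linarith) (by linarith) le_rfl,
      fun K hK => UnitDistance.upperMinkowskiDim_le_of_hasVolumeBound fun s hs =>
        hK.hasVolumeBound_unitPairs hd (by linarith) hs⟩⟩
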